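/- Let $\mathbb K$ be a field with ${\rm char}\,\mathbb K\neq 2$ and $\sqrt{-1}\in\mathbb K$. Let $n\ge 2$, let $a_1,\dots,a_n\ge 2$ be integers and let $(q_{ij})$ be an $n\times n$ matrix over $\mathbb K$ with $q_{ii}=1$ and $q_{ij}q_{ji}=1$ for all $i,j$. Let $$A=A({\bf q},{\bf a})=\mathbb K\langle x_1,\dots,x_n\rangle/\langle x_i^{a_i},\ x_jx_i-q_{ij}x_ix_j\ (1\le i,j\le n)\rangle ,$$ $V=\{v\in\mathbb N_0^n: v_i\le a_i-1\}$, and $x_v=x_1^{v_1}\cdots x_n^{v_n}$ for $v\in\mathbb N_0^n$, so that $\{x_v\}_{v\in V}$ is a basis of $A$, with dual basis $\{x_v^*\}_{v\in V}$ of $A^*$. Write ${\bf a-1}=(a_1-1,\dots,a_n-1)$. For $u,v\in\mathbb Z^n$ put ${\bf q}^{\langle u|v\rangle}=\prod_{i<j}q_{ij}^{u_jv_i}$ and $h_v={\bf q}^{\langle {\bf a-1}-v|v\rangle}/{\bf q}^{\langle v|{\bf a-1}-v\rangle}$; in particular $h_{e_i}=\prod_j q_{ij}^{a_j-1}$ for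 the unit vector $e_i$. Let $\mathcal N$ be the algebra automorphism of $A$ with $\phi(xy)=\phi(y\,\mathcal N(x))$ for all $x,y\in A$, where $\phi=x_{\bf a-1}^*$. A bi-Frobenius structure on the algebra $A$ consists of a coalgebra structure $(\Delta,\varepsilon)$ on $A$, $\phi\in A^*$ and $t\in A$ such that, with the antipode $S(a)=\sum\phi(t_1a)t_2$: $\varepsilon$ is an algebra homomorphism and $\Delta(1)=1\otimes1$; every element of $A^*$ is of the form $x\mapsto\phi(xa)$ with $a\in A$; every element of $A$ is of the form $\sum f(t_1)t_2$ with $f\in A^*$; and $S$ is an anti-homomorphism of algebras and of coalgebras. Its antipode is a permutation antipode if there are a permutation $\sigma$ of $V$ and scalars $c_v$ with $S(x_v)=c_vx_{\sigma(v)}$ for all $v\in V$. A permutation $\pi\in S_n$ is compatible if $a_{\pi(i)}=a_i$ and $q_{\pi(i)\pi(j)}=q_{ji}$ for all $i,j$. Let $\pi$ act on vectors by $\pi(v)=(v_{\pi^{-1}(1)},\dots,v_{\pi^{-1}(n)})$, and put $$I_1=\{i:\pi(i)=i,\ h_{e_i}=1,\ a_i\text{ even}\},\quad I_3=\{i:\pi(i)=i,\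 h_{e_i}=-1,\ a_i\text{ even}\},\quad J_3=\{i:\pi(i)\ne i,\ h_{e_i}=-1,\ a_i\text{ even}\}.$$ **Theorem.** (a) $A$ admits a bi-Frobenius structure with permutation antipode if and only if $\mathcal N^2={\rm Id}$ and there is a compatible permutation $\pi$ with $\pi^2={\rm Id}$ such that $|I_1|+|I_3|\neq0$ or $|J_3|/2$ is even. (b) Suppose that $\mathcal N^2={\rm Id}$ and let $\pi$ be any compatible permutation as in (a). Then there are $c_1,\dots,c_n\in\mathbb K$ with $$c_ic_{\pi(i)}=h_{e_i}\ (1\le i\le n),\qquad \prod_{j<k}\bigl({\bf q}^{\langle\pi(e_k)|\pi(e_j)\rangle}\bigr)^{(a_k-1)(a_j-1)}\prod_i c_i^{a_i-1}=1 ,$$ and for all such $c_i$ the following holds. For $v\in V$ put $$s_v=\prod_i c_i^{v_i}\prod_{j<k}\bigl({\bf q}^{\langle\pi(e_k)|\pi(e_j)\rangle}\bigr)^{v_jv_k},\qquad g_{{\bf a-1}-v,\pi(v)}=s_v/{\bf q}^{\langle{\bf a-1}-v|v\rangle}.$$ Then $\varepsilon(x_v)=\delta_{v,0}$, $\Delta(1)=1\otimes1$,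 $\Delta(x_v)=1\otimes x_v+x_v\otimes1$ for $v\in V\setminus\{0,{\bf a-1}\}$ and $\Delta(x_{\bf a-1})=\sum_{v\in V}g_{{\bf a-1}-v,\pi(v)}\,x_{{\bf a-1}-v}\otimes x_{\pi(v)}$ define a coalgebra structure on $A$ which, together with $\phi=x_{\bf a-1}^*$ and $t=x_{\bf a-1}$, is a bi-Frobenius structure, and its antipode is the permutation antipode given by $S(x_v)=s_v\,x_{\pi(v)}$ for $v\in V$. -/

import Mathlib

open scoped TensorProduct

/-! ## Bi-Frobenius algebras -/

section BiFrobenius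

variable {K A : Type*} [Field K] [Ring A] [Algebra K A]

/-- `φ` is a Frobenius homomorphism of the algebra `A`: `A^* = A ⇀ φ`, where
`(a ⇀ φ) x = φ (x a)`. -/
def IsFrobeniusHom (φ : Module.Dual K A) : Prop :=
  ∀ f : Module.Dual K A, ∃ a : A, ∀ x : A, f x = φ (x * a)

/-- `N` is the Nakayama automorphism of `A` with respect to `φ` (there is exactly one when `A` is
finite-dimensional and `φ` is a Frobenius homomorphism). -/
def IsNakayamaAutomorphism (φ : Module.Dual K A) (N : A ≃ₐ[K] A) : Prop :=
  ∀ x y : A, φ (x * y) = φ (y * N x)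

/-- The right action of the dual algebra on a coalgebra: `c ↼ f = ∑ f (c₁) c₂`. -/
noncomputable def coalgRightAct [Coalgebra K A] (c : A) (f : Module.Dual K A) : A :=
  TensorProduct.lid K A (LinearMap.rTensor A f (Coalgebra.comul (R := K) c))

/-- `(A, t)` is a Frobenius coalgebra: `A = t ↼ A^*`. -/
def IsFrobeniusElement (K : Type*) {A : Type*} [Field K] [Ring A] [Algebra K A] [Coalgebra K A]
    (t : A) : Prop :=
  ∀ c : A, ∃ f : Module.Dual K A, c = coalgRightAct t f

/-- The linear map `S a = ∑ φ (t₁ a) t₂`. -/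
noncomputable def biFrobeniusAntipode [Coalgebra K A] (φ : Module.Dual K A) (t : A) :
    A →ₗ[K] A where
  toFun a := coalgRightAct t (φ ∘ₗ LinearMap.mulRight K a)
  map_add' a b := by
    have h : φ ∘ₗ LinearMap.mulRight K (a + b)
        = φ ∘ₗ LinearMap.mulRight K a + φ ∘ₗ LinearMap.mulRight K b := by
      ext x; simp [mul_add]
    simp [coalgRightAct, h, LinearMap.rTensor_add]
  map_smul' r a := by
    have h : φ ∘ₗ LinearMap.mulRight K (r • a) = r • (φ ∘ₗ LinearMap.mulRight K a) := by
      ext x; simp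
    simp [coalgRightAct, h, LinearMap.rTensor_smul]

/-- The finite-dimensional algebra and coalgebra `A` together with `φ ∈ A^*` and `t ∈ A` is a
bi-Frobenius algebra, its antipode being `biFrobeniusAntipode φ t`. -/
structure IsBiFrobenius [FiniteDimensional K A] [Coalgebra K A]
    (φ : Module.Dual K A) (t : A) : Prop where
  counit_one : Coalgebra.counit (R := K) (1 : A) = 1
  counit_mul : ∀ a b : A, Coalgebra.counit (R := K) (a * b)
    = Coalgebra.counit (R := K) a * Coalgebra.counit (R := K) b
  comul_one : Coalgebra.comul (R := K) (1 : A) = 1 ⊗ₜ[K] 1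
  frobenius_algebra : IsFrobeniusHom φ
  frobenius_coalgebra : IsFrobeniusElement K t
  antipode_one : biFrobeniusAntipode φ t 1 = 1
  antipode_mul : ∀ a b : A,
    biFrobeniusAntipode φ t (a * b) = biFrobeniusAntipode φ t b * biFrobeniusAntipode φ t a
  counit_antipode : ∀ a : A,
    Coalgebra.counit (R := K) (biFrobeniusAntipode φ t a) = Coalgebra.counit (R := K) a
  comul_antipode : ∀ a : A,
    Coalgebra.comul (R := K) (biFrobeniusAntipode φ t a)
      = TensorProduct.map (biFrobeniusAntipode φ t) (biFrobeniusAntipode φ t)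
          (TensorProduct.comm K A A (Coalgebra.comul (R := K) a))

end BiFrobenius

/-! ## Quantum complete intersections -/

/-- The parameters `(q, a)` of a quantum complete intersection in `n` variables. -/
structure QCIParam (K : Type*) [Field K] (n : ℕ) where
  a : Fin n → ℕ
  q : Fin n → Fin n → K
  two_le_a : ∀ i, 2 ≤ a i
  q_self : ∀ i, q i i = 1
  q_mul_q : ∀ i j, q i j * q j i = 1

namespace QCIParam

variable {K : Type*} [Field K] {n : ℕ} (P : QCIParam K n)

/-- The defining relations `x_i ^ a_i = 0` and `x_j x_i = q_ij x_i x_j`. -/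
inductive Rel : FreeAlgebra K (Fin n) → FreeAlgebra K (Fin n) → Prop
  | pow (i : Fin n) : Rel (FreeAlgebra.ι K i ^ P.a i) 0
  | comm (i j : Fin n) : Rel (FreeAlgebra.ι K j * FreeAlgebra.ι K i)
      (P.q i j • (FreeAlgebra.ι K i * FreeAlgebra.ι K j))

/-- The quantum complete intersection `A(q, a)`. -/
abbrev Alg : Type _ := RingQuot P.Rel

/-- The generators `x_i`. -/
noncomputable def gen (i : Fin n) : P.Alg :=
  RingQuot.mkAlgHom K P.Rel (FreeAlgebra.ι K i)

/-- The ordered monomial `x_v = x_1 ^ v_1 ⋯ x_n ^ v_n`. -/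
noncomputable def x (v : Fin n → ℕ) : P.Alg :=
  ((List.finRange n).map fun i => P.gen i ^ v i).prod

/-- The exponent vector `a - 1`. -/
def top : Fin n → ℕ := fun i => P.a i - 1

/-- The set `V` of all `v ∈ ℕ ^ n` with `v_i ≤ a_i - 1`. -/
def V : Finset (Fin n → ℕ) := Finset.Iic P.top

theorem mem_V {v : Fin n → ℕ} : v ∈ P.V ↔ ∀ i, v i < P.a i := by
  simp only [V, Finset.mem_Iic, Pi.le_def, top]
  refine forall_congr' fun i => ?_
  have := P.two_le_a i
  omega

theorem top_mem : P.top ∈ P.V := by simp [V]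

/-! ### The monomials `x_v`, `v ∈ V`, form a basis -/

theorem gen_pow (i : Fin n) : P.gen i ^ P.a i = 0 := by
  rw [gen, ← map_pow, RingQuot.mkAlgHom_rel K (Rel.pow (P := P) i), map_zero]

theorem gen_comm (i j : Fin n) : P.gen j * P.gen i = P.q i j • (P.gen i * P.gen j) := by
  rw [gen, gen, ← map_mul, RingQuot.mkAlgHom_rel K (Rel.comm (P := P) i j), map_smul, map_mul]

theorem gen_mul_pow (i j : Fin n) (k : ℕ) :
    P.gen j * P.gen i ^ k = P.q i j ^ k • (P.gen i ^ k * P.gen j) := by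
  induction k with
  | zero => simp
  | succ k ih =>
    rw [pow_succ, ← mul_assoc, ih, smul_mul_assoc, mul_assoc, gen_comm, mul_smul_comm, smul_smul,
      mul_assoc, pow_succ]

theorem gen_mul_list (i : Fin n) (v : Fin n → ℕ) (l : List (Fin n)) (hl : l.Nodup) (hi : i ∈ l) :
    ∃ c : K, P.gen i * (l.map fun j => P.gen j ^ v j).prod
      = c • (l.map fun j => P.gen j ^ (v + Pi.single i 1 : Fin n → ℕ) j).prod := by
  induction l with
  | nil => simp at hi
  | cons j l ih =>
    obtain ⟨hj, hl⟩ := List.nodup_cons.1 hl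
    by_cases hij : i = j
    · subst hij
      refine ⟨1, ?_⟩
      have : (l.map fun j => P.gen j ^ (v + Pi.single i 1 : Fin n → ℕ) j) = l.map fun j => P.gen j ^ v j := by
        refine List.map_congr_left fun k hk => ?_
        have : k ≠ i := fun h => hj (h ▸ hk)
        simp [Pi.single_eq_of_ne this]
      rw [List.map_cons, List.map_cons, List.prod_cons, List.prod_cons, this, one_smul,
        ← mul_assoc, ← pow_succ']
      simp
    · obtain ⟨c, hc⟩ := ih hl (by simpa [hij] using hi)
      refine ⟨P.q j i ^ v j * c, ?_⟩
      rw [List.map_cons, List.map_cons, List.prod_cons, List.prod_cons, ← mul_assoc,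
        gen_mul_pow, smul_mul_assoc, mul_assoc, hc, mul_smul_comm, smul_smul]
      simp [Pi.single_eq_of_ne (Ne.symm hij)]

theorem x_eq_zero {v : Fin n → ℕ} (hv : v ∉ P.V) : P.x v = 0 := by
  rw [mem_V] at hv
  push Not at hv
  obtain ⟨i, hi⟩ := hv
  refine List.prod_eq_zero (List.mem_map.2 ⟨i, List.mem_finRange i, ?_⟩)
  obtain ⟨k, hk⟩ := Nat.exists_eq_add_of_le hi
  rw [hk, pow_add, gen_pow, zero_mul]

theorem x_zero : P.x 0 = 1 := by
  refine List.prod_eq_one fun y hy => ?_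
  obtain ⟨i, -, rfl⟩ := List.mem_map.1 hy
  simp

theorem span_x : ⊤ ≤ Submodule.span K (Set.range fun v : P.V => P.x v) := by
  set W := Submodule.span K (Set.range fun v : P.V => P.x v) with hW
  have hx : ∀ v, P.x v ∈ W := fun v => by
    by_cases hv : v ∈ P.V
    · exact Submodule.subset_span ⟨⟨v, hv⟩, rfl⟩
    · rw [x_eq_zero P hv]; exact W.zero_mem
  have hgen : ∀ i, ∀ w ∈ W, P.gen i * w ∈ W := fun i w hw => by
    induction hw using Submodule.span_induction with
    | mem y hy =>
      obtain ⟨v, rfl⟩ := hy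
      obtain ⟨c, hc⟩ := P.gen_mul_list i v _ (List.nodup_finRange n) (List.mem_finRange i)
      simp only [x] at hc ⊢
      rw [hc]
      exact W.smul_mem _ (hx _)
    | zero => simp
    | add y z _ _ hy hz => rw [mul_add]; exact W.add_mem hy hz
    | smul r y _ hy => rw [mul_smul_comm]; exact W.smul_mem _ hy
  have key : ∀ f : FreeAlgebra K (Fin n), ∀ w ∈ W, RingQuot.mkAlgHom K P.Rel f * w ∈ W := by
    intro f
    induction f using FreeAlgebra.induction with
    | grade0 r =>
      intro w hw
      rw [AlgHom.commutes, ← Algebra.smul_def]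
      exact W.smul_mem _ hw
    | grade1 i => exact hgen i
    | mul f g hf hg => intro w hw; rw [map_mul, mul_assoc]; exact hf _ (hg _ hw)
    | add f g hf hg => intro w hw; rw [map_add, add_mul]; exact W.add_mem (hf _ hw) (hg _ hw)
  intro y _
  obtain ⟨f, rfl⟩ := RingQuot.mkAlgHom_surjective K P.Rel y
  simpa using key f 1 (P.x_zero ▸ hx 0)

/-- The coefficient arising when `x_i` is moved into its place in `x_i x_v`. -/
noncomputable def opCoeff (i : Fin n) (v : Fin n → ℕ) : K := ∏ k ∈ Finset.Iio i, P.q k i ^ v k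

/-- Left multiplication by `x_i` on the space spanned by formal monomials. -/
noncomputable def op (i : Fin n) : Module.End K ((Fin n → ℕ) →₀ K) :=
  Finsupp.linearCombination K fun v =>
    if v i + 1 < P.a i then Finsupp.single (v + Pi.single i 1) (P.opCoeff i v) else 0

theorem op_single (i : Fin n) (v : Fin n → ℕ) (r : K) :
    P.op i (Finsupp.single v r) =
      if v i + 1 < P.a i then Finsupp.single (v + Pi.single i 1) (r * P.opCoeff i v) else 0 := by
  rw [op, Finsupp.linearCombination_single]
  split_ifs <;> simp

theorem opCoeff_add (i j : Fin n) (v : Fin n → ℕ) :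
    P.opCoeff j (v + Pi.single i 1) = P.opCoeff j v * if i < j then P.q i j else 1 := by
  simp only [opCoeff, Pi.add_apply, pow_add, Finset.prod_mul_distrib]
  congr 1
  split_ifs with h
  · rw [Finset.prod_eq_single i]
    · simp
    · intro b _ hb; simp [Pi.single_eq_of_ne hb]
    · intro hi; simp [h] at hi
  · refine Finset.prod_eq_one fun k hk => ?_
    have : k ≠ i := by rintro rfl; exact h (Finset.mem_Iio.1 hk)
    simp [Pi.single_eq_of_ne this]

theorem op_comm (i j : Fin n) : P.op j * P.op i = P.q i j • (P.op i * P.op j) := by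
  by_cases hij : i = j
  · subst hij; simp [P.q_self]
  refine Finsupp.lhom_ext fun v r => ?_
  simp only [Module.End.mul_apply, LinearMap.smul_apply, op_single]
  have h1 : (v + Pi.single i 1 : Fin n → ℕ) j = v j := by simp [Pi.single_eq_of_ne (Ne.symm hij)]
  have h2 : (v + Pi.single j 1 : Fin n → ℕ) i = v i := by simp [Pi.single_eq_of_ne hij]
  by_cases hi : v i + 1 < P.a i <;> by_cases hj : v j + 1 < P.a j <;>
    simp only [hi, hj, if_true, if_false, op_single, h1, h2, map_zero, smul_zero]
  rw [Finsupp.smul_single, add_right_comm, opCoeff_add, opCoeff_add]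
  congr 1
  rcases lt_or_gt_of_ne hij with h | h
  · simp only [h, h.not_gt, if_true, if_false, smul_eq_mul]; ring
  · simp only [h, h.not_gt, if_true, if_false, smul_eq_mul]
    linear_combination (-(r * P.opCoeff i v * P.opCoeff j v)) * P.q_mul_q i j

theorem op_pow_single (i : Fin n) (k : ℕ) (v : Fin n → ℕ) (r : K) (h : P.a i ≤ v i + (k + 1)) :
    (P.op i ^ (k + 1)) (Finsupp.single v r) = 0 := by
  induction k generalizing v r with
  | zero => rw [zero_add, pow_one, op_single, if_neg (by omega)]
  | succ k ih =>
    rw [pow_succ, Module.End.mul_apply, op_single]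
    split_ifs
    · refine ih _ _ ?_
      simp only [Pi.add_apply, Pi.single_eq_same]
      omega
    · simp

theorem op_pow (i : Fin n) : P.op i ^ P.a i = 0 := by
  refine Finsupp.lhom_ext fun v r => ?_
  obtain ⟨k, hk⟩ : ∃ k, P.a i = k + 1 := ⟨P.a i - 1, by have := P.two_le_a i; omega⟩
  rw [hk, op_pow_single P i k v r (by omega)]
  rfl

/-- The action of `A(q, a)` on the space spanned by formal monomials. -/
noncomputable def rep : P.Alg →ₐ[K] Module.End K ((Fin n → ℕ) →₀ K) :=
  RingQuot.liftAlgHom K ⟨FreeAlgebra.lift K P.op, by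
    intro f g h
    cases h with
    | pow i => simp [op_pow]
    | comm i j => simpa using P.op_comm i j⟩

theorem rep_gen (i : Fin n) : P.rep (P.gen i) = P.op i := by
  simp [rep, gen]

theorem op_pow_apply (i : Fin n) (k : ℕ) (v : Fin n → ℕ) (h : v i + k < P.a i)
    (hv : ∀ j < i, v j = 0) :
    (P.op i ^ k) (Finsupp.single v 1) = Finsupp.single (v + Pi.single i k) 1 := by
  induction k with
  | zero => simp
  | succ k ih =>
    rw [pow_succ', Module.End.mul_apply, ih (by omega), op_single, if_pos (by simp; omega)]
    have h1 : P.opCoeff i (v + Pi.single i k) = 1 := by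
      refine Finset.prod_eq_one fun j hj => ?_
      have hj := Finset.mem_Iio.1 hj
      simp [hv j hj, Pi.single_eq_of_ne hj.ne]
    rw [h1, one_mul, add_assoc, ← Pi.single_add]

theorem rep_list (v : Fin n → ℕ) (hv : v ∈ P.V) (l : List (Fin n)) (hl : l.Pairwise (· < ·)) :
    P.rep (l.map fun j => P.gen j ^ v j).prod (Finsupp.single 0 1)
      = Finsupp.single (fun j => if j ∈ l then v j else 0) 1 := by
  induction l with
  | nil => simp; rfl
  | cons i l ih =>
    obtain ⟨hi, hl⟩ := List.pairwise_cons.1 hl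
    have hil : i ∉ l := fun h => lt_irrefl _ (hi i h)
    rw [List.map_cons, List.prod_cons, map_mul, Module.End.mul_apply, ih hl, map_pow, rep_gen,
      op_pow_apply]
    · congr 1
      funext j
      by_cases hj : j = i
      · subst hj; simp [hil]
      · simp [hj]
    · simpa [hil] using P.mem_V.1 hv i
    · intro j hj
      have : j ∉ l := fun h => lt_asymm hj (hi j h)
      simp [this]

theorem rep_x (v : Fin n → ℕ) (hv : v ∈ P.V) :
    P.rep (P.x v) (Finsupp.single 0 1) = Finsupp.single v 1 := by
  rw [x, rep_list P v hv _ (List.sortedLT_finRange n).pairwise]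
  simp

theorem linearIndependent_x : LinearIndependent K fun v : P.V => P.x v := by
  let f : P.Alg →ₗ[K] ((Fin n → ℕ) →₀ K) :=
    (LinearMap.applyₗ (Finsupp.single 0 1)) ∘ₗ P.rep.toLinearMap
  refine LinearIndependent.of_comp f ?_
  have : (f ∘ fun v : P.V => P.x v) = fun v : P.V => Finsupp.single (v : Fin n → ℕ) (1 : K) := by
    funext v
    exact P.rep_x v v.2
  rw [this]
  exact (Finsupp.linearIndependent_single_one K (Fin n → ℕ)).comp _ Subtype.val_injective

/-- The standard basis `{x_v | v ∈ V}` of `A(q, a)`. -/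
noncomputable def stdBasis : Module.Basis P.V K P.Alg :=
  Module.Basis.mk P.linearIndependent_x P.span_x

theorem stdBasis_apply (v : P.V) : P.stdBasis v = P.x v := by simp [stdBasis]

instance : FiniteDimensional K P.Alg := Module.Finite.of_basis P.stdBasis

/-- The element `x_{a-1}^*` of the dual of the standard basis. -/
noncomputable def topDual : Module.Dual K P.Alg := P.stdBasis.coord ⟨P.top, P.top_mem⟩

/-! ### Structure coefficients and compatible permutations -/

/-- `q^{⟨u|v⟩} = ∏_{i<j} q_ij ^ (u_j v_i)` for integer vectors. -/
noncomputable def qpair (u v : Fin n → ℤ) : K :=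
  ∏ i, ∏ j ∈ Finset.Ioi i, P.q i j ^ (u j * v i)

/-- `h_v = q^{⟨a-1-v|v⟩} / q^{⟨v|a-1-v⟩}`. -/
noncomputable def h (v : Fin n → ℤ) : K :=
  P.qpair (fun i => (P.a i : ℤ) - 1 - v i) v / P.qpair v (fun i => (P.a i : ℤ) - 1 - v i)

/-- The unit vector `e_i`. -/
def e (i : Fin n) : Fin n → ℤ := Pi.single i 1

/-- `π(v) = (v_{π⁻¹(1)}, …, v_{π⁻¹(n)})`. -/
def permVec {R : Type*} (π : Equiv.Perm (Fin n)) (v : Fin n → R) : Fin n → R := fun i => v (π⁻¹ i)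

/-- `π` is a compatible permutation. -/
def Compatible (π : Equiv.Perm (Fin n)) : Prop :=
  (∀ i, P.a (π i) = P.a i) ∧ ∀ i j, P.q (π i) (π j) = P.q j i

/-- `q_π = ∏_{j<k} (q^{⟨π(e_k)|π(e_j)⟩}) ^ ((a_k - 1)(a_j - 1))`. -/
noncomputable def qperm (π : Equiv.Perm (Fin n)) : K :=
  ∏ j, ∏ k ∈ Finset.Ioi j,
    P.qpair (permVec π (e k)) (permVec π (e j)) ^ ((P.a k - 1) * (P.a j - 1))

/-- The scalars `c_i` satisfy `c_i c_{π(i)} = h_{e_i}` and `q_π ∏ c_i ^ (a_i - 1) = 1`. -/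
def Admissible (π : Equiv.Perm (Fin n)) (c : Fin n → K) : Prop :=
  (∀ i, c i * c (π i) = P.h (e i)) ∧ P.qperm π * ∏ i, c i ^ (P.a i - 1) = 1

open Classical in
/-- `I₁`: fixed points of `π` with `h_{e_i} = 1` and `a_i` even. -/
noncomputable def I₁ (π : Equiv.Perm (Fin n)) : Finset (Fin n) :=
  Finset.univ.filter fun i => π i = i ∧ P.h (e i) = 1 ∧ Even (P.a i)

open Classical in
/-- `I₃`: fixed points of `π` with `h_{e_i} = -1` and `a_i` even. -/
noncomputable def I₃ (π : Equiv.Perm (Fin n)) : Finset (Fin n) :=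
  Finset.univ.filter fun i => π i = i ∧ P.h (e i) = -1 ∧ Even (P.a i)

open Classical in
/-- `J₃`: indices moved by `π` with `h_{e_i} = -1` and `a_i` even. -/
noncomputable def J₃ (π : Equiv.Perm (Fin n)) : Finset (Fin n) :=
  Finset.univ.filter fun i => π i ≠ i ∧ P.h (e i) = -1 ∧ Even (P.a i)

/-! ### Permutation antipodes and the explicit structure -/

/-- `S` permutes the standard basis up to scalars. -/
def IsPermutationMap (S : P.Alg →ₗ[K] P.Alg) : Prop :=
  ∃ (σ : Equiv.Perm P.V) (c : P.V → K), ∀ v : P.V, S (P.x v) = c v • P.x (σ v)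

/-- `A(q, a)` admits a bi-Frobenius algebra structure with permutation antipode. -/
def AdmitsBiFrobeniusPerm : Prop :=
  ∃ (_ : Coalgebra K P.Alg) (φ : Module.Dual K P.Alg) (t : P.Alg),
    IsBiFrobenius φ t ∧ P.IsPermutationMap (biFrobeniusAntipode φ t)

/-- `N² = Id` for the canonical Nakayama automorphism `N`, the one with respect to `x_{a-1}^*`. -/
def NakayamaSqEqId : Prop :=
  ∃ N : P.Alg ≃ₐ[K] P.Alg, IsNakayamaAutomorphism P.topDual N ∧ ∀ y, N (N y) = y

/-- The coefficient of `x_{π(v)}` in `S (x_v)`: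
`∏ c_i ^ v_i * ∏_{j<k} (q^{⟨π(e_k)|π(e_j)⟩}) ^ (v_j v_k)`. -/
noncomputable def antipodeCoeff (π : Equiv.Perm (Fin n)) (c : Fin n → K) (v : Fin n → ℕ) : K :=
  (∏ i, c i ^ v i) *
    ∏ j, ∏ k ∈ Finset.Ioi j, P.qpair (permVec π (e k)) (permVec π (e j)) ^ (v j * v k)

/-- The coefficient `g_{a-1-v, π(v)}`. -/
noncomputable def comulCoeff (π : Equiv.Perm (Fin n)) (c : Fin n → K) (v : Fin n → ℕ) : K :=
  (P.qpair (fun i => (P.a i : ℤ) - 1 - v i) (fun i => (v i : ℤ)))⁻¹ * P.antipodeCoeff π c v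

/-- The counit `ε (x_v) = δ_{v,0}`. -/
noncomputable def counitMap : P.Alg →ₗ[K] K :=
  P.stdBasis.constr K fun v => if (v : Fin n → ℕ) = 0 then 1 else 0

/-- The comultiplication `Δ(1) = 1 ⊗ 1`, `Δ(x_v) = 1 ⊗ x_v + x_v ⊗ 1` for `v ≠ 0, a - 1`, and
`Δ(x_{a-1}) = ∑_v g_{a-1-v, π(v)} x_{a-1-v} ⊗ x_{π(v)}`. -/
noncomputable def comulMap (π : Equiv.Perm (Fin n)) (c : Fin n → K) :
    P.Alg →ₗ[K] P.Alg ⊗[K] P.Alg :=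
  P.stdBasis.constr K fun v =>
    if (v : Fin n → ℕ) = 0 then 1 ⊗ₜ[K] 1
    else if (v : Fin n → ℕ) = P.top then
      ∑ w ∈ P.V, P.comulCoeff π c w • (P.x (P.top - w) ⊗ₜ[K] P.x (permVec π w))
    else 1 ⊗ₜ[K] P.x v + P.x v ⊗ₜ[K] 1

/-- The map `S (x_v) = ∏ c_i ^ v_i * ∏_{j<k} (q^{⟨π(e_k)|π(e_j)⟩}) ^ (v_j v_k) * x_{π(v)}`. -/
noncomputable def antipodeMap (π : Equiv.Perm (Fin n)) (c : Fin n → K) : P.Alg →ₗ[K] P.Alg :=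
  P.stdBasis.constr K fun v => P.antipodeCoeff π c v • P.x (permVec π (v : Fin n → ℕ))

end QCIParam

/-! ### Monomial multiplication and the Frobenius form `topDual` -/

namespace QCIParam

variable {K : Type*} [Field K] {n : ℕ} (P : QCIParam K n)

/-! Write s_v for `antipodeCoeff π c v`. Compatibility of π says exactly that x_i ↦ c_i x_{π(i)}
extends to an anti-endomorphism, and the extension is x_v ↦ s_v x_{π(v)} (`antipodeCoeff_add`). If
also π² = 1 and c_i c_{π(i)} = h_{e_i}, then s_v s_{π(v)} = h_v (`antipodeCoeff_mul_permVec`), so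
the square of this map is the inverse of the Nakayama automorphism.

Existence: make every monomial strictly between 1 and x_{a-1} primitive, and choose Δ(x_{a-1}) so
that the formula ∑ φ(t₁a)t₂ returns this map. The counit axiom needs s_{a-1} = 1; compatibility of
the map with Δ(x_{a-1}) is the identity s_v s_{π(v)} = h_v. The remaining obstruction is a sign,
because s_{a-1}² = h_{a-1} = 1. A fixed point of π with a_i even lets the sign be changed by c_i ↦
-c_i. Without such a point everything cancels along the cycles of π except (-1)^(|J₃|/2)
(`antipodeCoeff_top_eq`).

Converse: nilpotency of the generators forces the counit, so t is an integral, hence a multiple of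
x_{a-1}, and S(t) = t. Then S² inverts the Nakayama automorphism of φ
(`antipode_antipode_nakayama`), which is conjugate to the canonical one by a unit. S permutes the
generators up to scalars, and conjugation is invisible on coefficients of degree one, so comparing
these yields π² = 1 and c_i c_{π(i)} = h_{e_i}. Compatibility inverts h along π while the last
equation makes it constant, so h_{e_i}² = 1. Finally S(x_{a-1}) = x_{a-1} gives s_{a-1} = 1, and the
sign computation applies. -/

theorem q_ne_zero (i j : Fin n) : P.q i j ≠ 0 :=
  left_ne_zero_of_mul_eq_one (P.q_mul_q i j)

theorem prod_Ioi {M : Type*} [CommMonoid M] (i : Fin n) (f : Fin n → M) :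
    ∏ j ∈ Finset.Ioi i, f j = ∏ j, if i < j then f j else 1 := by
  rw [← Finset.prod_filter]
  congr 1
  ext; simp

/-- `q^{⟨u|v⟩}` for vectors of natural numbers. -/
noncomputable def npair (u v : Fin n → ℕ) : K :=
  ∏ i, ∏ j, if i < j then P.q i j ^ (u j * v i) else 1

theorem qpair_natCast (u v : Fin n → ℕ) :
    P.qpair (fun i => (u i : ℤ)) (fun i => (v i : ℤ)) = P.npair u v := by
  simp only [qpair, npair, prod_Ioi]
  refine Finset.prod_congr rfl fun i _ => Finset.prod_congr rfl fun j _ => ?_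
  split_ifs
  · exact_mod_cast rfl
  · rfl

theorem npair_ne_zero (u v : Fin n → ℕ) : P.npair u v ≠ 0 := by
  refine Finset.prod_ne_zero_iff.2 fun i _ => Finset.prod_ne_zero_iff.2 fun j _ => ?_
  split_ifs
  · exact pow_ne_zero _ (P.q_ne_zero i j)
  · exact one_ne_zero

theorem npair_add_left (u u' v : Fin n → ℕ) :
    P.npair (u + u') v = P.npair u v * P.npair u' v := by
  simp only [npair, ← Finset.prod_mul_distrib]
  refine Finset.prod_congr rfl fun i _ => Finset.prod_congr rfl fun j _ => ?_
  split_ifs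
  · rw [Pi.add_apply, add_mul, pow_add]
  · simp

theorem npair_add_right (u v v' : Fin n → ℕ) :
    P.npair u (v + v') = P.npair u v * P.npair u v' := by
  simp only [npair, ← Finset.prod_mul_distrib]
  refine Finset.prod_congr rfl fun i _ => Finset.prod_congr rfl fun j _ => ?_
  split_ifs
  · rw [Pi.add_apply, mul_add, pow_add]
  · simp

@[simp] theorem npair_zero_left (v : Fin n → ℕ) : P.npair 0 v = 1 := by simp [npair]

@[simp] theorem npair_zero_right (v : Fin n → ℕ) : P.npair v 0 = 1 := by simp [npair]

theorem opCoeff_eq (i : Fin n) (v : Fin n → ℕ) :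
    P.opCoeff i v = P.npair (Pi.single i 1) v := by
  have : Finset.Iio i = Finset.univ.filter (· < i) := by ext; simp
  rw [opCoeff, npair, this, Finset.prod_filter]
  refine Finset.prod_congr rfl fun k _ => ?_
  rw [Finset.prod_eq_single i]
  · simp
  · intro b _ hb; simp [Pi.single_eq_of_ne hb]
  · simp

/-- Identities in the algebra can thus be checked on one vector, since the basis goes to distinct
formal monomials. -/
theorem rep_apply_injective : Function.Injective fun y : P.Alg => P.rep y (Finsupp.single 0 1) := by
  let f : P.Alg →ₗ[K] ((Fin n → ℕ) →₀ K) :=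
    (LinearMap.applyₗ (Finsupp.single 0 1)) ∘ₗ P.rep.toLinearMap
  have hf : (f ∘ P.stdBasis) = fun v : P.V => Finsupp.single (v : Fin n → ℕ) (1 : K) := by
    funext v
    simpa [f, stdBasis_apply] using P.rep_x v v.2
  have hli : LinearIndependent K (f ∘ P.stdBasis) := by
    rw [hf]
    exact (Finsupp.linearIndependent_single_one K (Fin n → ℕ)).comp _ Subtype.val_injective
  have : LinearMap.ker f = ⊥ := by
    rw [LinearMap.ker_eq_bot']
    intro y hy
    rw [← P.stdBasis.sum_repr y, map_sum] at hy
    simp only [map_smul] at hy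
    have := Fintype.linearIndependent_iff.1 hli _ hy
    rw [← P.stdBasis.sum_repr y]
    simp [this]
  exact LinearMap.ker_eq_bot.1 this

/-- No bound on v is needed: outside V the monomials vanish, on both sides at once. -/
theorem gen_mul_x (i : Fin n) (v : Fin n → ℕ) :
    P.gen i * P.x v = P.npair (Pi.single i 1) v • P.x (v + Pi.single i 1) := by
  rw [← opCoeff_eq]
  by_cases hv : v ∈ P.V
  · apply P.rep_apply_injective
    simp only [map_mul, Module.End.mul_apply, P.rep_x v hv, rep_gen, op_single, map_smul,
      LinearMap.smul_apply]
    split_ifs with h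
    · rw [P.rep_x, Finsupp.smul_single]
      · simp
      · rw [mem_V] at hv ⊢
        intro j
        by_cases hj : j = i
        · subst hj; simpa using h
        · simpa [Pi.single_eq_of_ne hj] using hv j
    · rw [P.x_eq_zero]
      · simp
      · rw [mem_V]
        intro h'
        exact h (by simpa using h' i)
  · rw [P.x_eq_zero hv, P.x_eq_zero, mul_zero, smul_zero]
    rw [mem_V] at hv ⊢
    refine fun h => hv fun j => lt_of_le_of_lt ?_ (h j)
    simp

theorem x_single (i : Fin n) : P.x (Pi.single i 1) = P.gen i := by
  have := P.gen_mul_x i 0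
  rw [x_zero] at this
  simpa using this.symm

/-- Induction on exponent vectors by adding unit vectors. -/
theorem vec_induction {p : (Fin n → ℕ) → Prop} (h0 : p 0)
    (h1 : ∀ v i, p v → p (v + Pi.single i 1)) (v : Fin n → ℕ) : p v := by
  induction hs : ∑ i, v i generalizing v with
  | zero =>
    have : v = 0 := by
      funext i
      exact (Finset.sum_eq_zero_iff.1 hs) i (Finset.mem_univ i)
    rwa [this]
  | succ k ih =>
    obtain ⟨i, hi⟩ : ∃ i, v i ≠ 0 := by
      by_contra! h
      simp [h] at hs
    have hv : v = (v - Pi.single i 1) + Pi.single i 1 := by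
      funext j
      by_cases hj : j = i
      · subst hj; simp; omega
      · simp [Pi.single_eq_of_ne hj]
    rw [hv]
    refine h1 _ _ (ih _ ?_)
    rw [hv] at hs
    simp only [Pi.add_apply, Finset.sum_add_distrib, Finset.sum_pi_single', Finset.mem_univ, if_true] at hs
    simpa using hs

theorem x_mul_x (u v : Fin n → ℕ) : P.x u * P.x v = P.npair u v • P.x (u + v) := by
  induction u using vec_induction with
  | h0 => simp [x_zero]
  | h1 u i ih =>
    have h := P.gen_mul_x i u
    have h' : P.x (u + Pi.single i 1) = (P.npair (Pi.single i 1) u)⁻¹ • (P.gen i * P.x u) := by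
      rw [h, smul_smul, inv_mul_cancel₀ (P.npair_ne_zero _ _), one_smul]
    rw [h', smul_mul_assoc, mul_assoc, ih, mul_smul_comm, gen_mul_x, smul_smul, smul_smul,
      npair_add_left, npair_add_right]
    congr 1
    · field_simp [P.npair_ne_zero]
    · congr 1; abel

theorem stdBasis_ext {M : Type*} [AddCommMonoid M] [Module K M] {f g : P.Alg →ₗ[K] M}
    (h : ∀ v ∈ P.V, f (P.x v) = g (P.x v)) : f = g :=
  P.stdBasis.ext fun v => by simpa [stdBasis_apply] using h v v.2

/-- The coefficient of `x_v` in an element. -/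
noncomputable def coeff (v : Fin n → ℕ) : Module.Dual K P.Alg :=
  P.stdBasis.constr K fun w => if (w : Fin n → ℕ) = v then 1 else 0

theorem constr_x {M : Type*} [AddCommMonoid M] [Module K M] (f : P.V → M) {v : Fin n → ℕ}
    (hv : v ∈ P.V) : P.stdBasis.constr K f (P.x v) = f ⟨v, hv⟩ := by
  have := P.stdBasis.constr_basis K f ⟨v, hv⟩
  rwa [stdBasis_apply] at this

theorem coeff_x {v w : Fin n → ℕ} (hv : v ∈ P.V) :
    P.coeff v (P.x w) = if w = v then 1 else 0 := by
  by_cases hw : w ∈ P.V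
  · rw [coeff, constr_x P _ hw]
  · rw [P.x_eq_zero hw, map_zero, if_neg]
    rintro rfl
    exact hw hv

theorem coeff_ext {y z : P.Alg} (h : ∀ v ∈ P.V, P.coeff v y = P.coeff v z) : y = z := by
  refine P.stdBasis.repr.injective (Finsupp.ext fun v => ?_)
  have : P.coeff v = P.stdBasis.coord v := by
    refine P.stdBasis_ext fun w hw => ?_
    rw [P.coeff_x v.2, ← P.stdBasis_apply ⟨w, hw⟩, Module.Basis.coord_apply,
      Module.Basis.repr_self, Finsupp.single_apply]
    simp [Subtype.ext_iff]
  have h' := h v v.2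
  rwa [this] at h'

theorem topDual_eq_coeff : P.topDual = P.coeff P.top := by
  refine P.stdBasis_ext fun w hw => ?_
  rw [P.coeff_x P.top_mem, topDual, ← P.stdBasis_apply ⟨w, hw⟩, Module.Basis.coord_apply,
      Module.Basis.repr_self, Finsupp.single_apply]
  simp [Subtype.ext_iff]

theorem topDual_x (v : Fin n → ℕ) : P.topDual (P.x v) = if v = P.top then 1 else 0 := by
  rw [topDual_eq_coeff, P.coeff_x P.top_mem]

theorem topDual_mul (u v : Fin n → ℕ) :
    P.topDual (P.x u * P.x v) = if u + v = P.top then P.npair u v else 0 := by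
  rw [x_mul_x, map_smul, topDual_x]; split_ifs <;> simp

theorem le_top {v : Fin n → ℕ} (hv : v ∈ P.V) : v ≤ P.top := by simpa [V] using hv

theorem top_sub_mem (v : Fin n → ℕ) : P.top - v ∈ P.V := by
  simp [V]

/-- Among basis monomials only x_v is completed to the top one by x_{a-1-v}. Up to nonzero scalars
the x_{a-1-v} are therefore the dual basis for the form, which gives nondegeneracy. -/
theorem topDual_mul_top_sub (y : P.Alg) {v : Fin n → ℕ} (hv : v ∈ P.V) :
    P.topDual (y * P.x (P.top - v)) = P.npair v (P.top - v) * P.coeff v y := by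
  have : P.topDual ∘ₗ LinearMap.mulRight K (P.x (P.top - v))
      = P.npair v (P.top - v) • P.coeff v := by
    refine P.stdBasis_ext fun w hw => ?_
    have hv' := P.le_top hv
    have h : w + (P.top - v) = P.top ↔ w = v := by
      constructor
      · intro h
        funext i
        have := congrFun h i
        have := hv' i
        simp at *
        omega
      · rintro rfl; exact add_tsub_cancel_of_le hv'
    simp only [LinearMap.comp_apply, LinearMap.mulRight_apply, topDual_mul, LinearMap.smul_apply,
      P.coeff_x hv, h]
    split_ifs with h
    · subst h; simp
    · simp
  simpa using LinearMap.congr_fun this y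

theorem eq_of_topDual_mul {y z : P.Alg} (h : ∀ a, P.topDual (y * a) = P.topDual (z * a)) :
    y = z := by
  refine P.coeff_ext fun v hv => ?_
  have := h (P.x (P.top - v))
  rw [topDual_mul_top_sub P _ hv, topDual_mul_top_sub P _ hv] at this
  exact mul_left_cancel₀ (P.npair_ne_zero _ _) this

theorem topDual_isFrobeniusHom : IsFrobeniusHom P.topDual := by
  intro f
  refine ⟨∑ v ∈ P.V, (f (P.x v) * (P.npair v (P.top - v))⁻¹) • P.x (P.top - v), fun y => ?_⟩
  have : f = P.topDual ∘ₗ LinearMap.mulRight K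
      (∑ v ∈ P.V, (f (P.x v) * (P.npair v (P.top - v))⁻¹) • P.x (P.top - v)) := by
    refine P.stdBasis_ext fun w hw => ?_
    simp only [LinearMap.comp_apply, LinearMap.mulRight_apply, Finset.mul_sum, mul_smul_comm,
      map_sum, map_smul]
    rw [Finset.sum_eq_single w]
    · rw [topDual_mul_top_sub P _ hw, P.coeff_x hw]
      simp [P.npair_ne_zero]
    · intro v hv hvw
      rw [topDual_mul_top_sub P _ hv, P.coeff_x hv, if_neg hvw.symm]
      simp
    · exact fun h => (h hw).elim
  exact LinearMap.congr_fun this y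

end QCIParam

namespace QCIParam

variable {K : Type*} [Field K] {n : ℕ} {P : QCIParam K n}

theorem induction_x {p : P.Alg → Prop} (hx : ∀ v ∈ P.V, p (P.x v))
    (hadd : ∀ y z, p y → p z → p (y + z)) (hsmul : ∀ (r : K) y, p y → p (r • y)) (y : P.Alg) :
    p y := by
  have hy := P.span_x (Submodule.mem_top (x := y))
  induction hy using Submodule.span_induction with
  | mem y hy => obtain ⟨v, rfl⟩ := hy; exact hx v v.2
  | zero => simpa using hsmul 0 _ (hx P.top P.top_mem)
  | add y z _ _ hy hz => exact hadd _ _ hy hz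
  | smul r y _ hy => exact hsmul _ _ hy

variable (P)

/-! ### The scalars `h_v` and the Nakayama automorphism -/

/-- `h_v` as a multiplicative function of `v ∈ ℕ ^ n`. -/
noncomputable def hnat (v : Fin n → ℕ) : K := P.npair P.top v / P.npair v P.top

theorem hnat_ne_zero (v : Fin n → ℕ) : P.hnat v ≠ 0 :=
  div_ne_zero (P.npair_ne_zero _ _) (P.npair_ne_zero _ _)

@[simp] theorem hnat_zero : P.hnat 0 = 1 := by simp [hnat]

@[simp] theorem hnat_top : P.hnat P.top = 1 := div_self (P.npair_ne_zero _ _)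

theorem hnat_add (u v : Fin n → ℕ) : P.hnat (u + v) = P.hnat u * P.hnat v := by
  rw [hnat, npair_add_left, npair_add_right, hnat, hnat, mul_div_mul_comm]

/-- The self-pairing of v cancels in the quotient, so pairing with a-1 or with a-1-v gives the same
h_v. -/
theorem hnat_eq_of_add_eq_top {u v : Fin n → ℕ} (h : u + v = P.top) :
    P.hnat v = P.npair u v / P.npair v u := by
  rw [hnat, ← h, npair_add_left, npair_add_right,
    mul_div_mul_right _ _ (P.npair_ne_zero _ _)]

theorem cast_top_sub {v : Fin n → ℕ} (hv : v ∈ P.V) :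
    (fun i => (P.a i : ℤ) - 1 - v i) = fun i => (((P.top - v) i : ℕ) : ℤ) := by
  funext i
  have := P.mem_V.1 hv i
  simp only [top, Pi.sub_apply]
  omega

theorem e_eq_cast (i : Fin n) : e i = fun j => ((Pi.single i 1 : Fin n → ℕ) j : ℤ) := by
  funext j
  by_cases hj : j = i
  · subst hj; simp [e]
  · simp [e, Pi.single_eq_of_ne hj]

theorem single_mem (i : Fin n) : Pi.single i 1 ∈ P.V := by
  rw [mem_V]
  intro j
  have := P.two_le_a j
  by_cases hj : j = i
  · subst hj; simp; omega
  · simp [Pi.single_eq_of_ne hj]; omega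

theorem h_e (i : Fin n) : P.h (e i) = P.hnat (Pi.single i 1) := by
  rw [e_eq_cast, h, cast_top_sub P (P.single_mem i), qpair_natCast, qpair_natCast,
    ← hnat_eq_of_add_eq_top P (tsub_add_cancel_of_le (P.le_top (P.single_mem i)))]

theorem h_e_eq_prod (i : Fin n) : P.h (e i) = ∏ j, P.q i j ^ (P.a j - 1) := by
  rw [h_e, hnat, div_eq_iff (P.npair_ne_zero _ _)]
  have h1 : P.npair P.top (Pi.single i 1) = ∏ j, if i < j then P.q i j ^ (P.a j - 1) else 1 := by
    rw [npair, Finset.prod_eq_single i]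
    · simp [top]
    · intro b _ hb; simp [Pi.single_eq_of_ne hb]
    · simp
  have h2 : P.npair (Pi.single i 1) P.top = ∏ j, if j < i then P.q j i ^ (P.a j - 1) else 1 := by
    rw [npair]
    refine Finset.prod_congr rfl fun j _ => ?_
    rw [Finset.prod_eq_single i]
    · simp [top]
    · intro b _ hb; simp [Pi.single_eq_of_ne hb]
    · simp
  rw [h1, h2, ← Finset.prod_mul_distrib]
  refine Finset.prod_congr rfl fun j _ => ?_
  rcases lt_trichotomy i j with h | h | h
  · simp [h, h.not_gt]
  · subst h; simp [P.q_self]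
  · simp [h, h.not_gt, ← mul_pow, P.q_mul_q]

/-- The linear map scaling each `x_v` by `f v`. -/
noncomputable def diag (f : (Fin n → ℕ) → K) : P.Alg →ₗ[K] P.Alg :=
  P.stdBasis.constr K fun v => f v • P.x v

theorem diag_x (f : (Fin n → ℕ) → K) (v : Fin n → ℕ) : P.diag f (P.x v) = f v • P.x v := by
  by_cases hv : v ∈ P.V
  · rw [diag, constr_x P _ hv]
  · simp [P.x_eq_zero hv]

/-- The Nakayama automorphism `x_v ↦ h_v⁻¹ x_v`. -/
noncomputable def nakayama : P.Alg ≃ₐ[K] P.Alg :=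
  AlgEquiv.ofLinearEquiv
    (LinearEquiv.ofLinearMap (P.diag fun v => (P.hnat v)⁻¹) (P.diag P.hnat)
      (P.stdBasis_ext fun v _ => by simp [diag_x, smul_smul, P.hnat_ne_zero])
      (P.stdBasis_ext fun v _ => by simp [diag_x, smul_smul, P.hnat_ne_zero]))
    (by
      have := P.diag_x (fun v => (P.hnat v)⁻¹) 0
      simpa [x_zero] using this)
    (by
      intro y z
      simp only [LinearEquiv.coe_ofLinearMap]
      induction y using induction_x with
      | hadd y y' h h' => simp only [add_mul, map_add, h, h']
      | hsmul r y h => simp only [smul_mul_assoc, map_smul, h]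
      | hx u hu =>
        induction z using induction_x with
        | hadd y y' h h' => simp only [mul_add, map_add, h, h']
        | hsmul r y h => simp only [mul_smul_comm, map_smul, h]
        | hx v hv =>
          simp only [x_mul_x, map_smul, diag_x, smul_mul_assoc, mul_smul_comm, smul_smul,
            hnat_add, mul_inv]
          congr 1
          ring)

theorem nakayama_x (v : Fin n → ℕ) : P.nakayama (P.x v) = (P.hnat v)⁻¹ • P.x v := by
  rw [nakayama, AlgEquiv.ofLinearEquiv_apply, LinearEquiv.coe_ofLinearMap, diag_x]

theorem isNakayamaAutomorphism_nakayama : IsNakayamaAutomorphism P.topDual P.nakayama := by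
  intro y z
  induction y using induction_x with
  | hadd y y' h h' => simp only [add_mul, mul_add, map_add, h, h']
  | hsmul r y h => simp only [smul_mul_assoc, mul_smul_comm, map_smul, h]
  | hx u hu =>
    induction z using induction_x with
    | hadd y y' h h' => simp only [add_mul, mul_add, map_add, h, h']
    | hsmul r y h => simp only [smul_mul_assoc, mul_smul_comm, map_smul, h]
    | hx v hv =>
      rw [nakayama_x, mul_smul_comm, map_smul, topDual_mul, topDual_mul, add_comm v u]
      split_ifs with h
      · rw [add_comm] at h
        rw [hnat_eq_of_add_eq_top P h, inv_div, smul_eq_mul, div_mul_cancel₀ _ (P.npair_ne_zero _ _)]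
      · simp

theorem nakayama_unique {N : P.Alg ≃ₐ[K] P.Alg} (hN : IsNakayamaAutomorphism P.topDual N) :
    N = P.nakayama := by
  ext y
  obtain ⟨z, hz⟩ := P.nakayama.surjective (N y)
  rw [← hz]
  congr 1
  refine P.eq_of_topDual_mul fun a => ?_
  rw [P.isNakayamaAutomorphism_nakayama, hz, ← hN]

theorem hnat_eq_prod (v : Fin n → ℕ) : P.hnat v = ∏ i, P.h (e i) ^ v i := by
  induction v using vec_induction with
  | h0 => simp
  | h1 v i ih =>
    simp only [hnat_add, ih, Pi.add_apply, pow_add, Finset.prod_mul_distrib]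
    rw [Finset.prod_eq_single (M := K) (s := Finset.univ) (f := fun j => P.h (e j) ^ (Pi.single i 1 : Fin n → ℕ) j) i]
    · simp [h_e]
    · intro b _ hb; simp [Pi.single_eq_of_ne hb]
    · simp

theorem x_ne_zero {v : Fin n → ℕ} (hv : v ∈ P.V) : P.x v ≠ 0 := fun h => by
  have := P.coeff_x (w := v) hv
  simp [h] at this

/-- The automorphism is unique and diagonal with eigenvalues h_v⁻¹, which are multiplicative in v,
so the generators decide. -/
theorem nakayamaSqEqId_iff : P.NakayamaSqEqId ↔ ∀ i, P.h (e i) ^ 2 = 1 := by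
  constructor
  · rintro ⟨N, hN, h2⟩ i
    have := h2 (P.x (Pi.single i 1))
    rw [P.nakayama_unique hN, nakayama_x, map_smul, nakayama_x, smul_smul, ← h_e] at this
    have h3 := congrArg (P.coeff (Pi.single i 1)) this
    rw [map_smul, P.coeff_x (P.single_mem i), if_pos rfl, smul_eq_mul, mul_one, ← mul_inv,
      inv_eq_one, ← sq] at h3
    exact h3
  · intro h
    refine ⟨P.nakayama, P.isNakayamaAutomorphism_nakayama, fun y => ?_⟩
    induction y using induction_x with
    | hadd y y' h h' => simp only [map_add, h, h']
    | hsmul r y h => simp only [map_smul, h]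
    | hx u hu =>
      rw [nakayama_x, map_smul, nakayama_x, smul_smul, ← mul_inv, hnat_eq_prod,
        ← Finset.prod_mul_distrib, Finset.prod_eq_one, inv_one, one_smul]
      intro i _
      rw [← mul_pow, ← sq, h, one_pow]

/-! ### Compatible permutations -/

variable {P} {π : Equiv.Perm (Fin n)}

theorem permVec_single (i : Fin n) :
    permVec π (Pi.single i 1 : Fin n → ℕ) = Pi.single (π i) 1 := by
  funext j
  rw [permVec, Pi.single_apply, Pi.single_apply]
  simp only [Equiv.Perm.inv_eq_iff_eq, eq_comm (a := j)]

theorem permVec_involutive (h : π ^ 2 = 1) (v : Fin n → ℕ) : permVec π (permVec π v) = v := by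
  funext i
  have : π⁻¹ * π⁻¹ = 1 := by rw [← mul_inv_rev, ← sq, h, inv_one]
  simp only [permVec, ← Equiv.Perm.mul_apply, this, Equiv.Perm.one_apply]

theorem apply_apply_of_sq (h : π ^ 2 = 1) (i : Fin n) : π (π i) = i := by
  rw [← Equiv.Perm.mul_apply, ← sq, h, Equiv.Perm.one_apply]

theorem permVec_injective : Function.Injective (permVec π : (Fin n → ℕ) → Fin n → ℕ) := by
  intro u v h
  funext i
  simpa [permVec] using congrFun h (π i)

theorem Compatible.a_inv (h : P.Compatible π) (i : Fin n) : P.a (π⁻¹ i) = P.a i := by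
  have := h.1 (π⁻¹ i)
  simpa using this.symm

theorem Compatible.permVec_top (h : P.Compatible π) : permVec π P.top = P.top := by
  funext i
  simp only [permVec, top, h.a_inv]

theorem Compatible.permVec_mem (h : P.Compatible π) {v : Fin n → ℕ} :
    permVec π v ∈ P.V ↔ v ∈ P.V := by
  rw [mem_V, mem_V]
  constructor
  · intro hv i
    have := hv (π i)
    simpa [permVec, h.1] using this
  · intro hv i
    have := hv (π⁻¹ i)
    rwa [h.a_inv] at this

variable (P π) in
/-- `q^{⟨π(e_k)|π(e_j)⟩}`. -/
noncomputable def twist (j k : Fin n) : K := if π j < π k then P.q (π j) (π k) else 1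

theorem qpair_permVec_e (j k : Fin n) :
    P.qpair (permVec π (e k)) (permVec π (e j)) = P.twist π j k := by
  have h (i : Fin n) : permVec π (e i) = fun l => ((Pi.single (π i) 1 : Fin n → ℕ) l : ℤ) := by
    rw [← permVec_single, e_eq_cast]; rfl
  rw [h, h, qpair_natCast, npair, Finset.prod_eq_single (π j), Finset.prod_eq_single (π k)]
  · simp [twist]
  · intro b _ hb; simp [Pi.single_eq_of_ne hb]
  · simp
  · intro b _ hb; simp [Pi.single_eq_of_ne hb]
  · simp

theorem antipodeCoeff_eq (c : Fin n → K) (v : Fin n → ℕ) :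
    P.antipodeCoeff π c v = (∏ i, c i ^ v i) *
      ∏ j, ∏ k, if j < k then P.twist π j k ^ (v j * v k) else 1 := by
  simp only [antipodeCoeff, prod_Ioi, qpair_permVec_e]

theorem qperm_mul_prod (c : Fin n → K) :
    P.qperm π * ∏ i, c i ^ (P.a i - 1) = P.antipodeCoeff π c P.top := by
  rw [mul_comm, antipodeCoeff, qperm]
  congr 1
  simp only [top, mul_comm]

theorem npair_permVec (u v : Fin n → ℕ) :
    P.npair (permVec π u) (permVec π v) = ∏ j, ∏ k, P.twist π j k ^ (u k * v j) := by
  rw [npair, ← Equiv.prod_comp π]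
  refine Finset.prod_congr rfl fun j _ => ?_
  rw [← Equiv.prod_comp π]
  refine Finset.prod_congr rfl fun k _ => ?_
  simp only [twist, permVec, Equiv.Perm.inv_def, Equiv.symm_apply_apply]
  split_ifs <;> simp

/-- Exactly one of the two twists is nontrivial, according to the order of π(j) and π(k). All later
identities in q reduce to this one, pair by pair. -/
theorem Compatible.q_mul_twist (h : P.Compatible π) {j k : Fin n} (hjk : j ≠ k) :
    P.q j k * P.twist π j k = P.twist π k j := by
  rw [twist, twist, h.2, h.2]
  have : π j ≠ π k := fun h => hjk (π.injective h)
  rcases lt_or_gt_of_ne this with h | h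
  · simp [h, h.not_gt, P.q_mul_q]
  · simp [h, h.not_gt]

theorem prod_prod_eq_prod_lt {M : Type*} [CommMonoid M] (f : Fin n → Fin n → M)
    (hf : ∀ i, f i i = 1) :
    ∏ j, ∏ k, f j k = ∏ j, ∏ k, if j < k then f j k * f k j else 1 := by
  have h1 : ∏ j, ∏ k, f j k = (∏ j, ∏ k, if j < k then f j k else 1) *
      ∏ j, ∏ k, if k < j then f j k else 1 := by
    simp only [← Finset.prod_mul_distrib]
    refine Finset.prod_congr rfl fun j _ => Finset.prod_congr rfl fun k _ => ?_
    rcases lt_trichotomy j k with h | h | h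
    · simp [h, h.not_gt]
    · subst h; simp [hf]
    · simp [h, h.not_gt]
  rw [h1, Finset.prod_comm (f := fun j k => if k < j then f j k else 1)]
  simp only [← Finset.prod_mul_distrib]
  refine Finset.prod_congr rfl fun j _ => Finset.prod_congr rfl fun k _ => ?_
  split_ifs <;> simp

theorem npair_permVec_eq_lt (u v : Fin n → ℕ) :
    P.npair (permVec π u) (permVec π v) = ∏ j, ∏ k, if j < k then
      P.twist π j k ^ (u k * v j) * P.twist π k j ^ (u j * v k) else 1 := by
  rw [npair_permVec, prod_prod_eq_prod_lt]
  simp [twist]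

/-- The commutation factor of x_u and x_v is inverse to that of their images under π, as an
order-reversing map requires. -/
theorem Compatible.npair_mul_npair_permVec (h : P.Compatible π) (u v : Fin n → ℕ) :
    P.npair u v * P.npair (permVec π u) (permVec π v)
      = P.npair v u * P.npair (permVec π v) (permVec π u) := by
  rw [npair_permVec_eq_lt, npair_permVec_eq_lt, npair, npair]
  simp only [← Finset.prod_mul_distrib]
  refine Finset.prod_congr rfl fun j _ => Finset.prod_congr rfl fun k _ => ?_
  split_ifs with hjk
  · rw [← h.q_mul_twist hjk.ne]
    ring
  · rfl

theorem Compatible.hnat_permVec (h : P.Compatible π) (v : Fin n → ℕ) :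
    P.hnat (permVec π v) = (P.hnat v)⁻¹ := by
  have := h.npair_mul_npair_permVec P.top v
  rw [h.permVec_top] at this
  rw [hnat, hnat, inv_div, div_eq_div_iff (P.npair_ne_zero _ _) (P.npair_ne_zero _ _)]
  linear_combination this

/-- This is the cocycle identity that makes x_v ↦ s_v x_{π(v)} reverse products. The quadratic
exponent (u+v)_j (u+v)_k produces the cross terms, which match the two pairings by `q_mul_twist`. -/
theorem Compatible.antipodeCoeff_add (h : P.Compatible π) (c : Fin n → K) (u v : Fin n → ℕ) :
    P.npair u v * P.antipodeCoeff π c (u + v)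
      = P.antipodeCoeff π c u * P.antipodeCoeff π c v * P.npair (permVec π v) (permVec π u) := by
  have key : P.npair u v * ∏ j, ∏ k, (if j < k then
        P.twist π j k ^ ((u + v) j * (u + v) k) else 1)
      = (∏ j, ∏ k, if j < k then P.twist π j k ^ (u j * u k) else 1) *
        (∏ j, ∏ k, if j < k then P.twist π j k ^ (v j * v k) else 1) *
        P.npair (permVec π v) (permVec π u) := by
    rw [npair_permVec_eq_lt, npair]
    simp only [← Finset.prod_mul_distrib]
    refine Finset.prod_congr rfl fun j _ => Finset.prod_congr rfl fun k _ => ?_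
    split_ifs with hjk
    · rw [← h.q_mul_twist hjk.ne, Pi.add_apply, Pi.add_apply]
      ring
    · simp
  simp only [antipodeCoeff_eq, Pi.add_apply, pow_add, Finset.prod_mul_distrib] at key ⊢
  linear_combination (∏ i, c i ^ u i) * (∏ i, c i ^ v i) * key

@[simp] theorem antipodeCoeff_zero (c : Fin n → K) : P.antipodeCoeff π c 0 = 1 := by
  simp [antipodeCoeff]

@[simp] theorem antipodeCoeff_single (c : Fin n → K) (i : Fin n) :
    P.antipodeCoeff π c (Pi.single i 1) = c i := by
  rw [antipodeCoeff_eq, Finset.prod_eq_single i]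
  · rw [Finset.prod_eq_one, Pi.single_eq_same, pow_one, mul_one]
    intro j _
    refine Finset.prod_eq_one fun k _ => ?_
    split_ifs with hjk
    · by_cases hj : j = i
      · subst hj; simp [Pi.single_eq_of_ne hjk.ne']
      · simp [Pi.single_eq_of_ne hj]
    · rfl
  · intro b _ hb; simp [Pi.single_eq_of_ne hb]
  · simp

/-- Both sides are multiplicative in v, since the cocycles for v and π(v) cancel by
`npair_mul_npair_permVec`; on unit vectors the claim is the hypothesis on c. -/
theorem Compatible.antipodeCoeff_mul_permVec (h : P.Compatible π) (hπ : π ^ 2 = 1)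
    {c : Fin n → K} (hc : ∀ i, c i * c (π i) = P.h (e i)) (v : Fin n → ℕ) :
    P.antipodeCoeff π c v * P.antipodeCoeff π c (permVec π v) = P.hnat v := by
  induction v using vec_induction with
  | h0 =>
    have : permVec π (0 : Fin n → ℕ) = 0 := rfl
    simp [this]
  | h1 v i ih =>
    set u : Fin n → ℕ := Pi.single i 1 with hu
    have hi : P.antipodeCoeff π c u * P.antipodeCoeff π c (permVec π u) = P.hnat u := by
      rw [hu, permVec_single, antipodeCoeff_single, antipodeCoeff_single, hc, h_e]
    have h1 := h.antipodeCoeff_add c v u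
    have h2 := h.antipodeCoeff_add c (permVec π v) (permVec π u)
    rw [permVec_involutive hπ, permVec_involutive hπ] at h2
    have h3 := h.npair_mul_npair_permVec v u
    have h4 : permVec π (v + u) = permVec π v + permVec π u := rfl
    rw [hnat_add, ← ih, ← hi, h4]
    have h5 := mul_ne_zero (P.npair_ne_zero v u) (P.npair_ne_zero (permVec π v) (permVec π u))
    refine mul_left_cancel₀ h5 ?_
    set A := P.antipodeCoeff π c
    calc _ = (P.npair v u * A (v + u)) *
          (P.npair (permVec π v) (permVec π u) * A (permVec π v + permVec π u)) := by ring
      _ = _ := by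
        rw [h1, h2]
        linear_combination -(A v * A u * A (permVec π v) * A (permVec π u)) * h3

theorem Compatible.antipodeMap_x (h : P.Compatible π) (c : Fin n → K) (v : Fin n → ℕ) :
    P.antipodeMap π c (P.x v) = P.antipodeCoeff π c v • P.x (permVec π v) := by
  by_cases hv : v ∈ P.V
  · rw [antipodeMap, constr_x P _ hv]
  · rw [P.x_eq_zero hv, P.x_eq_zero (mt h.permVec_mem.1 hv)]
    simp

theorem Compatible.antipodeMap_one (h : P.Compatible π) (c : Fin n → K) :
    P.antipodeMap π c 1 = 1 := by
  have := h.antipodeMap_x c 0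
  rwa [x_zero, antipodeCoeff_zero, one_smul, show permVec π (0 : Fin n → ℕ) = 0 from rfl,
    x_zero] at this

theorem Compatible.antipodeMap_mul (h : P.Compatible π) (c : Fin n → K) (y z : P.Alg) :
    P.antipodeMap π c (y * z) = P.antipodeMap π c z * P.antipodeMap π c y := by
  induction y using induction_x with
  | hadd y y' h h' => simp only [add_mul, mul_add, map_add, h, h']
  | hsmul r y h => simp only [smul_mul_assoc, mul_smul_comm, map_smul, h]
  | hx u hu =>
    induction z using induction_x with
    | hadd y y' h h' => simp only [add_mul, mul_add, map_add, h, h']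
    | hsmul r y h => simp only [smul_mul_assoc, mul_smul_comm, map_smul, h]
    | hx v hv =>
      rw [x_mul_x, map_smul, h.antipodeMap_x, h.antipodeMap_x, h.antipodeMap_x, smul_mul_assoc,
        mul_smul_comm, x_mul_x, smul_smul, smul_smul, smul_smul, h.antipodeCoeff_add,
        add_comm u v]
      rw [show permVec π (v + u) = permVec π v + permVec π u from rfl]
      congr 1
      ring

end QCIParam

/-! ### The explicit coalgebra structure and its antipode -/

namespace QCIParam

variable {K : Type*} [Field K] {n : ℕ} {P : QCIParam K n} {π : Equiv.Perm (Fin n)} {c : Fin n → K}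

theorem zero_mem (P : QCIParam K n) : 0 ∈ P.V := by simp [V]

theorem top_ne_zero (P : QCIParam K n) (hn : 0 < n) : P.top ≠ 0 := fun h => by
  have := congrFun h ⟨0, hn⟩
  have := P.two_le_a ⟨0, hn⟩
  simp only [top, Pi.zero_apply] at *
  omega

theorem counitMap_eq_coeff : P.counitMap = P.coeff 0 := rfl

theorem counitMap_x (v : Fin n → ℕ) : P.counitMap (P.x v) = if v = 0 then 1 else 0 := by
  rw [counitMap_eq_coeff, P.coeff_x P.zero_mem]

theorem counitMap_one : P.counitMap (1 : P.Alg) = 1 := by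
  rw [← x_zero, counitMap_x, if_pos rfl]

theorem counitMap_mul (y z : P.Alg) : P.counitMap (y * z) = P.counitMap y * P.counitMap z := by
  induction y using induction_x with
  | hadd y y' h h' => simp only [add_mul, map_add, h, h']
  | hsmul r y h => simp only [smul_mul_assoc, map_smul, h]
  | hx u hu =>
    induction z using induction_x with
    | hadd y y' h h' => simp only [mul_add, map_add, h, h']
    | hsmul r y h => simp only [mul_smul_comm, map_smul, h, smul_eq_mul]; ring
    | hx v hv =>
      have : u + v = 0 ↔ u = 0 ∧ v = 0 := by
        simp only [funext_iff, Pi.add_apply, Pi.zero_apply, Nat.add_eq_zero_iff, forall_and]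
      rw [x_mul_x, map_smul, counitMap_x, counitMap_x, counitMap_x]
      by_cases hu : u = 0
      · subst hu; simp
      · simp [this, hu]

theorem comulMap_one : P.comulMap π c (1 : P.Alg) = 1 ⊗ₜ[K] 1 := by
  rw [← x_zero, comulMap, constr_x P _ P.zero_mem, if_pos rfl, x_zero]

theorem comulMap_x {v : Fin n → ℕ} (hv : v ∈ P.V) (h0 : v ≠ 0) (ht : v ≠ P.top) :
    P.comulMap π c (P.x v) = 1 ⊗ₜ[K] P.x v + P.x v ⊗ₜ[K] 1 := by
  rw [comulMap, constr_x P _ hv, if_neg h0, if_neg ht]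

theorem comulMap_top (hn : 0 < n) : P.comulMap π c (P.x P.top)
    = ∑ w ∈ P.V, P.comulCoeff π c w • (P.x (P.top - w) ⊗ₜ[K] P.x (permVec π w)) := by
  rw [comulMap, constr_x P _ P.top_mem, if_neg (P.top_ne_zero hn), if_pos rfl]

theorem comulCoeff_eq {w : Fin n → ℕ} (hw : w ∈ P.V) :
    P.comulCoeff π c w = (P.npair (P.top - w) w)⁻¹ * P.antipodeCoeff π c w := by
  rw [comulCoeff, cast_top_sub P hw, qpair_natCast]

theorem top_sub_eq_zero {w : Fin n → ℕ} (hw : w ∈ P.V) : P.top - w = 0 ↔ w = P.top := by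
  rw [tsub_eq_zero_iff_le]
  exact ⟨fun h => le_antisymm (P.le_top hw) h, fun h => h.ge⟩

theorem top_sub_eq_top {w : Fin n → ℕ} (hw : w ∈ P.V) : P.top - w = P.top ↔ w = 0 := by
  constructor
  · intro h
    funext i
    have h1 := P.le_top hw i
    have h2 := congrFun h i
    simp only [Pi.sub_apply, Pi.zero_apply] at *
    omega
  · rintro rfl; exact tsub_zero _

theorem permVec_zero : permVec π (0 : Fin n → ℕ) = 0 := rfl

theorem permVec_eq_zero {w : Fin n → ℕ} : permVec π w = 0 ↔ w = 0 :=
  permVec_injective.eq_iff' permVec_zero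

theorem Compatible.permVec_eq_top (h : P.Compatible π) {w : Fin n → ℕ} :
    permVec π w = P.top ↔ w = P.top :=
  permVec_injective.eq_iff' h.permVec_top

variable (P) in
/-- The exponents of the nontrivial monomials different from the top one. -/
noncomputable def middle : Finset (Fin n → ℕ) := (P.V.erase 0).erase P.top

theorem mem_middle {w : Fin n → ℕ} : w ∈ P.middle ↔ w ≠ P.top ∧ w ≠ 0 ∧ w ∈ P.V := by
  simp [middle]

theorem antipodeCoeff_top (hc : P.Admissible π c) : P.antipodeCoeff π c P.top = 1 := by
  rw [← qperm_mul_prod, hc.2]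

/-- The terms w = 0 and w = a-1 form the primitive part. The second has coefficient s_{a-1}, so the
normalisation in `Admissible` is what makes the counit axiom hold. -/
theorem Compatible.comulMap_top_eq_middle (h : P.Compatible π) (hn : 0 < n)
    (hc : P.Admissible π c) : P.comulMap π c (P.x P.top)
      = P.x P.top ⊗ₜ[K] 1 + (1 ⊗ₜ[K] P.x P.top + ∑ w ∈ P.middle,
        P.comulCoeff π c w • (P.x (P.top - w) ⊗ₜ[K] P.x (permVec π w))) := by
  rw [comulMap_top hn, ← Finset.add_sum_erase _ _ P.zero_mem,
    ← Finset.add_sum_erase _ _ (Finset.mem_erase.2 ⟨P.top_ne_zero hn, P.top_mem⟩), middle]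
  congr 1
  · rw [comulCoeff_eq P.zero_mem, permVec_zero, x_zero]
    simp
  · rw [comulCoeff_eq P.top_mem, h.permVec_top, antipodeCoeff_top hc]
    simp [x_zero]

theorem comulMap_top_sub {w : Fin n → ℕ} (hw : w ∈ P.middle) :
    P.comulMap π c (P.x (P.top - w)) = 1 ⊗ₜ[K] P.x (P.top - w) + P.x (P.top - w) ⊗ₜ[K] 1 := by
  obtain ⟨h1, h2, h3⟩ := mem_middle.1 hw
  exact comulMap_x (P.top_sub_mem w) (mt (top_sub_eq_zero h3).1 h1) (mt (top_sub_eq_top h3).1 h2)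

theorem Compatible.comulMap_permVec (h : P.Compatible π) {w : Fin n → ℕ} (hw : w ∈ P.middle) :
    P.comulMap π c (P.x (permVec π w))
      = 1 ⊗ₜ[K] P.x (permVec π w) + P.x (permVec π w) ⊗ₜ[K] 1 := by
  obtain ⟨h1, h2, h3⟩ := mem_middle.1 hw
  exact comulMap_x (h.permVec_mem.2 h3) (mt permVec_eq_zero.1 h2) (mt h.permVec_eq_top.1 h1)

theorem counitMap_top_sub {w : Fin n → ℕ} (hw : w ∈ P.middle) :
    P.counitMap (P.x (P.top - w)) = 0 := by
  obtain ⟨h1, h2, h3⟩ := mem_middle.1 hw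
  rw [counitMap_x, if_neg (mt (top_sub_eq_zero h3).1 h1)]

theorem counitMap_permVec {w : Fin n → ℕ} (hw : w ∈ P.middle) :
    P.counitMap (P.x (permVec π w)) = 0 := by
  obtain ⟨h1, h2, h3⟩ := mem_middle.1 hw
  rw [counitMap_x, if_neg (mt permVec_eq_zero.1 h2)]

/-- The coalgebra structure given by `counitMap` and `comulMap`. -/
noncomputable abbrev Compatible.coalgebra (h : P.Compatible π) (hn : 0 < n)
    (hc : P.Admissible π c) : Coalgebra K P.Alg where
  comul := P.comulMap π c
  counit := P.counitMap
  coassoc := by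
    refine P.stdBasis_ext fun v hv => ?_
    simp only [LinearMap.comp_apply, LinearEquiv.coe_coe]
    by_cases h0 : v = 0
    · subst h0
      simp [x_zero, comulMap_one]
    by_cases ht : v = P.top
    · subst ht
      rw [h.comulMap_top_eq_middle hn hc]
      simp only [map_add, map_sum, map_smul, LinearMap.rTensor_tmul, LinearMap.lTensor_tmul,
        comulMap_one, TensorProduct.assoc_tmul, h.comulMap_top_eq_middle hn hc,
        TensorProduct.add_tmul, TensorProduct.tmul_add, TensorProduct.sum_tmul,
        TensorProduct.tmul_sum, ← TensorProduct.smul_tmul', TensorProduct.tmul_smul]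
      -- Both legs of a middle term are primitive. The two expansions share the terms with 1 in the
      -- central slot; the others are supplied by Δ(x_{a-1}) ⊗ 1 and 1 ⊗ Δ(x_{a-1}).
      have h1 : ∑ w ∈ P.middle, P.comulCoeff π c w • TensorProduct.assoc K P.Alg P.Alg P.Alg
            (P.comulMap π c (P.x (P.top - w)) ⊗ₜ[K] P.x (permVec π w))
          = ∑ w ∈ P.middle, P.comulCoeff π c w •
              (1 ⊗ₜ[K] (P.x (P.top - w) ⊗ₜ[K] P.x (permVec π w))) +
            ∑ w ∈ P.middle, P.comulCoeff π c w •
              (P.x (P.top - w) ⊗ₜ[K] (1 ⊗ₜ[K] P.x (permVec π w))) := by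
        rw [← Finset.sum_add_distrib]
        refine Finset.sum_congr rfl fun w hw => ?_
        rw [comulMap_top_sub hw, TensorProduct.add_tmul, map_add, smul_add,
          TensorProduct.assoc_tmul, TensorProduct.assoc_tmul]
      have h2 : ∑ w ∈ P.middle, P.comulCoeff π c w •
            (P.x (P.top - w) ⊗ₜ[K] P.comulMap π c (P.x (permVec π w)))
          = ∑ w ∈ P.middle, P.comulCoeff π c w •
              (P.x (P.top - w) ⊗ₜ[K] (1 ⊗ₜ[K] P.x (permVec π w))) +
            ∑ w ∈ P.middle, P.comulCoeff π c w •
              (P.x (P.top - w) ⊗ₜ[K] (P.x (permVec π w) ⊗ₜ[K] (1 : P.Alg))) := by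
        rw [← Finset.sum_add_distrib]
        refine Finset.sum_congr rfl fun w hw => ?_
        rw [h.comulMap_permVec hw, TensorProduct.tmul_add, smul_add]
      rw [h1, h2]
      abel
    · rw [comulMap_x hv h0 ht]
      simp only [map_add, LinearMap.rTensor_tmul, LinearMap.lTensor_tmul, comulMap_one,
        comulMap_x hv h0 ht, TensorProduct.add_tmul, TensorProduct.tmul_add,
        TensorProduct.assoc_tmul]
      abel
  rTensor_counit_comp_comul := by
    refine P.stdBasis_ext fun v hv => ?_
    simp only [LinearMap.comp_apply, TensorProduct.mk_apply]
    by_cases h0 : v = 0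
    · subst h0
      simp [x_zero, comulMap_one, counitMap_one]
    by_cases ht : v = P.top
    · subst ht
      rw [h.comulMap_top_eq_middle hn hc]
      simp only [map_add, map_sum, map_smul, LinearMap.rTensor_tmul, counitMap_one]
      rw [Finset.sum_eq_zero fun w hw => by rw [counitMap_top_sub hw]; simp]
      simp [counitMap_x, h0]
    · rw [comulMap_x hv h0 ht]
      simp [counitMap_x, h0, counitMap_one]
  lTensor_counit_comp_comul := by
    refine P.stdBasis_ext fun v hv => ?_
    simp only [LinearMap.comp_apply, LinearMap.flip_apply, TensorProduct.mk_apply]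
    by_cases h0 : v = 0
    · subst h0
      simp [x_zero, comulMap_one, counitMap_one]
    by_cases ht : v = P.top
    · subst ht
      rw [h.comulMap_top_eq_middle hn hc]
      simp only [map_add, map_sum, map_smul, LinearMap.lTensor_tmul, counitMap_one]
      rw [Finset.sum_eq_zero fun w hw => by rw [counitMap_permVec hw]; simp]
      simp [counitMap_x, h0]
    · rw [comulMap_x hv h0 ht]
      simp [counitMap_x, h0, counitMap_one]

theorem Compatible.coalgRightAct_top (h : P.Compatible π) (hn : 0 < n) (hc : P.Admissible π c)
    (f : Module.Dual K P.Alg) :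
    letI := h.coalgebra hn hc
    coalgRightAct (P.x P.top) f
      = ∑ w ∈ P.V, (P.comulCoeff π c w * f (P.x (P.top - w))) • P.x (permVec π w) := by
  simp only [coalgRightAct]
  rw [show @Coalgebra.comul K P.Alg _ _ _ (h.coalgebra hn hc).toCoalgebraStruct
    = P.comulMap π c from rfl, comulMap_top hn]
  simp [smul_smul]

/-- Only the summand w = v survives φ(t₁ x_v), and the denominator of g is exactly φ(x_{a-1-v} x_v).
-/
theorem Compatible.biFrobeniusAntipode_eq (h : P.Compatible π) (hn : 0 < n)
    (hc : P.Admissible π c) :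
    letI := h.coalgebra hn hc
    biFrobeniusAntipode P.topDual (P.x P.top) = P.antipodeMap π c := by
  refine P.stdBasis_ext fun v hv => ?_
  refine (h.coalgRightAct_top hn hc _).trans ?_
  rw [h.antipodeMap_x, Finset.sum_eq_single v]
  · rw [LinearMap.comp_apply, LinearMap.mulRight_apply, topDual_mul,
      if_pos (tsub_add_cancel_of_le (P.le_top hv)), comulCoeff_eq hv, mul_right_comm,
      inv_mul_cancel₀ (P.npair_ne_zero _ _), one_mul]
  · intro w hw hwv
    rw [LinearMap.comp_apply, LinearMap.mulRight_apply, topDual_mul, if_neg, mul_zero, zero_smul]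
    intro h'
    refine hwv ?_
    funext i
    have h1 : w i ≤ P.top i := P.le_top hw i
    have h2 : P.top i - w i + v i = P.top i := congrFun h' i
    omega
  · exact fun h => (h hv).elim

theorem Compatible.isFrobeniusElement_top (h : P.Compatible π) (hn : 0 < n)
    (hπ : π ^ 2 = 1) (hc : P.Admissible π c) :
    letI := h.coalgebra hn hc
    IsFrobeniusElement K (P.x P.top) := by
  intro y
  have hs (w : Fin n → ℕ) : P.antipodeCoeff π c w ≠ 0 := by
    have := h.antipodeCoeff_mul_permVec hπ hc.1 w
    exact left_ne_zero_of_mul (this ▸ P.hnat_ne_zero w)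
  -- Δ(x_{a-1}) matches the basis element x_{a-1-w} with x_{π(w)}, with nonzero coefficient, so a
  -- functional producing y can be read off coordinatewise.
  refine ⟨∑ w ∈ P.V, ((P.comulCoeff π c w)⁻¹ * P.coeff (permVec π w) y) • P.coeff (P.top - w), ?_⟩
  rw [h.coalgRightAct_top hn hc]
  refine P.coeff_ext fun v hv => ?_
  have hv' : permVec π v ∈ P.V := h.permVec_mem.2 hv
  rw [map_sum, Finset.sum_eq_single (permVec π v)]
  · rw [permVec_involutive hπ, map_smul, P.coeff_x hv, if_pos rfl, LinearMap.sum_apply,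
      Finset.sum_eq_single (permVec π v)]
    · have hg : P.comulCoeff π c (permVec π v) ≠ 0 := by
        rw [comulCoeff_eq hv']
        exact mul_ne_zero (inv_ne_zero (P.npair_ne_zero _ _)) (hs _)
      rw [LinearMap.smul_apply, P.coeff_x (P.top_sub_mem _), if_pos rfl, permVec_involutive hπ]
      simp only [smul_eq_mul, mul_one]
      rw [mul_inv_cancel_left₀ hg]
    · intro w hw hwv
      rw [LinearMap.smul_apply, P.coeff_x (P.top_sub_mem _), if_neg, smul_zero]
      intro h'
      refine hwv ?_
      rw [← tsub_tsub_cancel_of_le (P.le_top hw), ← h', tsub_tsub_cancel_of_le (P.le_top hv')]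
    · exact fun h => (h hv').elim
  · intro w hw hwv
    rw [map_smul, P.coeff_x hv, if_neg, smul_zero]
    rintro rfl
    exact hwv (permVec_involutive hπ w).symm
  · exact fun h => (h hv').elim

theorem Compatible.comul_antipodeMap (h : P.Compatible π) (hn : 0 < n) (hπ : π ^ 2 = 1)
    (hc : P.Admissible π c) (y : P.Alg) :
    P.comulMap π c (P.antipodeMap π c y)
      = TensorProduct.map (P.antipodeMap π c) (P.antipodeMap π c)
          (TensorProduct.comm K P.Alg P.Alg (P.comulMap π c y)) := by
  induction y using induction_x with
  | hadd y y' h h' => simp only [map_add, h, h']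
  | hsmul r y h => simp only [map_smul, h]
  | hx v hv =>
    by_cases h0 : v = 0
    · subst h0
      simp [x_zero, h.antipodeMap_one, comulMap_one]
    by_cases ht : v = P.top
    · subst ht
      rw [h.antipodeMap_x, h.permVec_top, antipodeCoeff_top hc, one_smul, comulMap_top hn]
      simp only [map_sum, map_smul, TensorProduct.comm_tmul, TensorProduct.map_tmul,
        h.antipodeMap_x, permVec_involutive hπ, TensorProduct.smul_tmul', TensorProduct.tmul_smul,
        smul_smul]
      -- The flip exchanges w and a-1-w. After reindexing, equality of coefficients is s_u s_{π(u)}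
      -- = h_u for u = a-1-w.
      refine Finset.sum_nbij' (fun w => P.top - w) (fun w => P.top - w)
        (fun w _ => P.top_sub_mem w) (fun w _ => P.top_sub_mem w)
        (fun w hw => tsub_tsub_cancel_of_le (P.le_top hw))
        (fun w hw => tsub_tsub_cancel_of_le (P.le_top hw)) fun w hw => ?_
      rw [tsub_tsub_cancel_of_le (P.le_top hw)]
      congr 2
      rw [comulCoeff_eq hw, comulCoeff_eq (P.top_sub_mem w), tsub_tsub_cancel_of_le (P.le_top hw)]
      have h1 := h.antipodeCoeff_mul_permVec hπ hc.1 (P.top - w)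
      rw [hnat_eq_of_add_eq_top P (add_tsub_cancel_of_le (P.le_top hw)),
        eq_div_iff (P.npair_ne_zero _ _)] at h1
      have h2 := P.npair_ne_zero (P.top - w) w
      have h3 := P.npair_ne_zero w (P.top - w)
      field_simp
      linear_combination -(P.antipodeCoeff π c w) * h1
    · have hv' := h.permVec_mem.2 hv
      have h0' := mt (permVec_eq_zero (π := π)).1 h0
      have ht' := mt h.permVec_eq_top.1 ht
      rw [h.antipodeMap_x, map_smul, comulMap_x hv' h0' ht', comulMap_x hv h0 ht]
      simp only [map_add, TensorProduct.comm_tmul, TensorProduct.map_tmul, h.antipodeMap_one,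
        h.antipodeMap_x, TensorProduct.smul_tmul', TensorProduct.tmul_smul, smul_add]
      abel

theorem Compatible.counitMap_antipodeMap (h : P.Compatible π) (y : P.Alg) :
    P.counitMap (P.antipodeMap π c y) = P.counitMap y := by
  induction y using induction_x with
  | hadd y y' h h' => simp only [map_add, h, h']
  | hsmul r y h => simp only [map_smul, h]
  | hx v hv =>
    rw [h.antipodeMap_x, map_smul, counitMap_x, counitMap_x]
    by_cases h0 : v = 0
    · subst h0; simp [permVec_zero]
    · simp [h0, permVec_eq_zero]

theorem Compatible.isBiFrobenius (h : P.Compatible π) (hn : 0 < n) (hπ : π ^ 2 = 1)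
    (hc : P.Admissible π c) :
    letI := h.coalgebra hn hc
    IsBiFrobenius P.topDual (P.x P.top) := by
  let _ := h.coalgebra hn hc
  have hS : biFrobeniusAntipode P.topDual (P.x P.top) = P.antipodeMap π c :=
    h.biFrobeniusAntipode_eq hn hc
  exact
  { counit_one := counitMap_one
    counit_mul := counitMap_mul
    comul_one := comulMap_one
    frobenius_algebra := P.topDual_isFrobeniusHom
    frobenius_coalgebra := h.isFrobeniusElement_top hn hπ hc
    antipode_one := by rw [hS, h.antipodeMap_one]
    antipode_mul := fun a b => by rw [hS, h.antipodeMap_mul]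
    counit_antipode := fun a => by rw [hS]; exact h.counitMap_antipodeMap a
    comul_antipode := fun a => by rw [hS]; exact h.comul_antipodeMap hn hπ hc a }

theorem Compatible.isPermutationMap (h : P.Compatible π) :
    P.IsPermutationMap (P.antipodeMap π c) := by
  refine ⟨Equiv.ofBijective (fun v : P.V => ⟨permVec π (v : Fin n → ℕ), h.permVec_mem.2 v.2⟩)
    (Finite.injective_iff_bijective.1 fun u v huv => ?_), fun v => P.antipodeCoeff π c v,
    fun v => h.antipodeMap_x c v⟩
  exact Subtype.ext (permVec_injective (congrArg Subtype.val huv))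

end QCIParam

/-! ### Existence of the scalars and the sign obstruction -/

namespace QCIParam

variable {K : Type*} [Field K] {n : ℕ} {P : QCIParam K n} {π : Equiv.Perm (Fin n)} {c : Fin n → K}

theorem Compatible.h_e_apply (h : P.Compatible π) (i : Fin n) :
    P.h (e (π i)) = (P.h (e i))⁻¹ := by
  rw [h_e, h_e, ← permVec_single, h.hnat_permVec]

theorem Compatible.h_e_apply_of_sq (h : P.Compatible π) (hN : ∀ i, P.h (e i) ^ 2 = 1)
    (i : Fin n) : P.h (e (π i)) = P.h (e i) := by
  rw [h.h_e_apply]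
  exact inv_eq_of_mul_eq_one_left (by rw [← sq, hN])

theorem h_e_eq_one_or (hN : ∀ i, P.h (e i) ^ 2 = 1) (i : Fin n) :
    P.h (e i) = 1 ∨ P.h (e i) = -1 :=
  mul_self_eq_one_iff.1 (by rw [← sq, hN])

theorem Compatible.exists_mul_apply_eq (h : P.Compatible π) (hπ : π ^ 2 = 1)
    (hN : ∀ i, P.h (e i) ^ 2 = 1) (hsqrt : IsSquare (-1 : K)) :
    ∃ c : Fin n → K, ∀ i, c i * c (π i) = P.h (e i) := by
  have hs (i : Fin n) : ∃ r, r * r = P.h (e i) := by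
    rcases h_e_eq_one_or hN i with h | h
    · exact ⟨1, by rw [h, one_mul]⟩
    · obtain ⟨r, hr⟩ := hsqrt
      exact ⟨r, by rw [h, hr]⟩
  choose r hr using hs
  -- On a 2-cycle h is constant, so its value can be placed on the smaller index. Only a fixed point
  -- with h = -1 needs √-1.
  refine ⟨fun i => if π i = i then r i else if i < π i then P.h (e i) else 1, fun i => ?_⟩
  have h2 := apply_apply_of_sq hπ i
  rcases lt_trichotomy i (π i) with hi | hi | hi
  · simp [h2, hi, hi.ne, hi.ne', hi.not_gt]
  · simp [← hi, hr]
  · simp [h2, hi, hi.ne, hi.ne', hi.not_gt, h.h_e_apply_of_sq hN]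

theorem Compatible.antipodeCoeff_top_eq_one_or (h : P.Compatible π) (hπ : π ^ 2 = 1)
    (hc : ∀ i, c i * c (π i) = P.h (e i)) :
    P.antipodeCoeff π c P.top = 1 ∨ P.antipodeCoeff π c P.top = -1 := by
  have := h.antipodeCoeff_mul_permVec hπ hc P.top
  rw [h.permVec_top, hnat_top] at this
  exact mul_self_eq_one_iff.1 this

theorem antipodeCoeff_top_neg {i : Fin n} (hi : Even (P.a i)) :
    P.antipodeCoeff π (fun j => (if j = i then -1 else 1) * c j) P.top
      = -P.antipodeCoeff π c P.top := by
  rw [antipodeCoeff_eq, antipodeCoeff_eq, ← neg_mul]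
  congr 1
  simp only [mul_pow, Finset.prod_mul_distrib]
  rw [Finset.prod_eq_single i]
  · have : Odd (P.top i) := by
      have := P.two_le_a i
      exact Nat.Even.sub_odd (by omega) hi odd_one
    simp [this.neg_one_pow]
  · intro b _ hb; simp [hb]
  · simp

theorem even_top {i : Fin n} (hi : ¬ Even (P.a i)) : Even (P.top i) :=
  Nat.Odd.sub_odd (Nat.not_even_iff_odd.1 hi) odd_one

/-- π acts on pairs of indices, and the factors of a pair and its image cancel. For a fixed pair
both indices are fixed, so q_jk = ±1, while the exponent is even because a_j is odd. -/
theorem Compatible.prod_twist_eq_one (h : P.Compatible π) (hπ : π ^ 2 = 1)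
    (hfix : ∀ i, π i = i → ¬ Even (P.a i)) :
    ∏ j, ∏ k, (if j < k then P.twist π j k ^ (P.top j * P.top k) else 1) = 1 := by
  rw [← Fintype.prod_prod_type']
  have hm (i : Fin n) : P.top (π i) = P.top i := by simp [top, h.1]
  refine Finset.prod_ninvolution (fun p => (π p.1, π p.2)) (fun p => ?_) (fun p hp hg => ?_)
    (fun _ => Finset.mem_univ _) (fun p => by simp [apply_apply_of_sq hπ])
  · obtain ⟨j, k⟩ := p
    simp only [twist, apply_apply_of_sq hπ, hm, h.2]
    by_cases h1 : j < k <;> by_cases h2 : π j < π k <;> simp [h1, h2, ← mul_pow, P.q_mul_q]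
  · obtain ⟨j, k⟩ := p
    obtain ⟨hj, hk⟩ := Prod.mk.inj hg
    refine hp ?_
    have hq : P.q j k = P.q k j := by
      have := h.2 j k
      rwa [hj, hk] at this
    have hq' : P.q j k ^ 2 = 1 := by
      have := P.q_mul_q j k
      rwa [← hq, ← sq] at this
    obtain ⟨m, hm⟩ := (even_top (hfix j hj)).mul_right (P.top k)
    simp only [twist, hj, hk, hm, ← two_mul, pow_mul]
    split_ifs <;> simp [hq']

/-- In ∏_j q_ij^(a_j-1) the factors at j and π(j) are inverse to each other; a fixed j has q_ij = ±1
and an even exponent. -/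
theorem Compatible.h_e_eq_one_of_fixed (h : P.Compatible π) (hπ : π ^ 2 = 1)
    (hfix : ∀ i, π i = i → ¬ Even (P.a i)) {i : Fin n} (hi : π i = i) : P.h (e i) = 1 := by
  rw [h_e_eq_prod]
  have hq (j : Fin n) : P.q i (π j) = P.q j i := by
    have := h.2 i j
    rwa [hi] at this
  refine Finset.prod_ninvolution π (fun j => ?_) (fun j hj hg => ?_)
    (fun _ => Finset.mem_univ _) (apply_apply_of_sq hπ)
  · rw [hq, h.1, ← mul_pow, P.q_mul_q, one_pow]
  · refine hj ?_
    have hq' : P.q i j ^ 2 = 1 := by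
      have := P.q_mul_q i j
      rwa [← hq, hg, ← sq] at this
    obtain ⟨m, hm⟩ := even_top (hfix j hg)
    rw [top] at hm
    rw [hm, ← two_mul, pow_mul, hq', one_pow]

theorem mem_J₃ {i : Fin n} : i ∈ P.J₃ π ↔ π i ≠ i ∧ P.h (e i) = -1 ∧ Even (P.a i) := by
  simp [J₃]

theorem Compatible.apply_mem_J₃ (h : P.Compatible π) {i : Fin n} (hi : i ∈ P.J₃ π) :
    π i ∈ P.J₃ π := by
  rw [mem_J₃] at *
  refine ⟨fun h' => hi.1 (π.injective h'), ?_, ?_⟩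
  · rw [h.h_e_apply, hi.2.1, inv_neg, inv_one]
  · rw [h.1]; exact hi.2.2

/-- J₃ is a union of 2-cycles, so the natural-number division is exact and counts the cycles by
their smaller elements. -/
theorem Compatible.card_J₃ (h : P.Compatible π) (hπ : π ^ 2 = 1) :
    (P.J₃ π).card / 2 = ((P.J₃ π).filter fun i => i < π i).card := by
  have h1 := Finset.card_filter_add_card_filter_not (s := P.J₃ π) (fun i => i < π i)
  have h2 : ((P.J₃ π).filter fun i => ¬ i < π i).card
      = ((P.J₃ π).filter fun i => i < π i).card := by
    refine Finset.card_nbij' π π ?_ ?_ (fun i _ => apply_apply_of_sq hπ i)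
      (fun i _ => apply_apply_of_sq hπ i)
    · intro i hi
      simp only [Finset.coe_filter, Set.mem_ofPred_eq] at hi ⊢
      refine ⟨h.apply_mem_J₃ hi.1, ?_⟩
      rw [apply_apply_of_sq hπ]
      exact lt_of_le_of_ne (not_lt.1 hi.2) (mem_J₃.1 hi.1).1
    · intro i hi
      simp only [Finset.coe_filter, Set.mem_ofPred_eq] at hi ⊢
      refine ⟨h.apply_mem_J₃ hi.1, ?_⟩
      rw [apply_apply_of_sq hπ]
      exact hi.2.not_gt
  omega

/-- A 2-cycle contributes (c_i c_{π(i)})^(a_i-1) = h_{e_i}^(a_i-1), which is -1 on J₃ and 1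
elsewhere. A fixed point has c_i² = 1 and an even exponent. -/
theorem Compatible.prod_pow_top (h : P.Compatible π) (hπ : π ^ 2 = 1)
    (hN : ∀ i, P.h (e i) ^ 2 = 1) (hfix : ∀ i, π i = i → ¬ Even (P.a i))
    (hc : ∀ i, c i * c (π i) = P.h (e i)) :
    ∏ i, c i ^ P.top i = (-1) ^ ((P.J₃ π).card / 2) := by
  have hm (i : Fin n) : P.top (π i) = P.top i := by simp [top, h.1]
  have h1 : ∏ i, c i ^ P.top i = (∏ i, if i < π i then c i ^ P.top i else 1) *
      ∏ i, if π i < i then c i ^ P.top i else 1 := by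
    rw [← Finset.prod_mul_distrib]
    refine Finset.prod_congr rfl fun i _ => ?_
    rcases lt_trichotomy i (π i) with hi | hi | hi
    · simp [hi, hi.not_gt]
    · obtain ⟨m, hm⟩ := even_top (hfix i hi.symm)
      have := hc i
      rw [← hi, h.h_e_eq_one_of_fixed hπ hfix hi.symm] at this
      simp [← hi, hm, ← two_mul, pow_mul, sq, this]
    · simp [hi, hi.not_gt]
  rw [h1, ← Equiv.prod_comp π fun i => if π i < i then c i ^ P.top i else 1,
    ← Finset.prod_mul_distrib, h.card_J₃ hπ, ← Finset.prod_const, Finset.prod_filter,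
    ← Finset.prod_subset (Finset.subset_univ (P.J₃ π))]
  · refine Finset.prod_congr rfl fun i hi => ?_
    rw [apply_apply_of_sq hπ, hm]
    split_ifs
    · have := P.two_le_a i
      have : Odd (P.top i) := Nat.Even.sub_odd (by omega) (mem_J₃.1 hi).2.2 odd_one
      rw [← mul_pow, hc, (mem_J₃.1 hi).2.1, this.neg_one_pow]
    · simp
  · intro i _ hi
    rw [apply_apply_of_sq hπ, hm]
    split_ifs with hlt
    · rw [← mul_pow, hc]
      rcases h_e_eq_one_or hN i with h' | h'
      · rw [h', one_pow]
      · rw [h', (even_top fun hev => hi (mem_J₃.2 ⟨hlt.ne', h', hev⟩)).neg_one_pow]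
    · simp

theorem Compatible.antipodeCoeff_top_eq (h : P.Compatible π) (hπ : π ^ 2 = 1)
    (hN : ∀ i, P.h (e i) ^ 2 = 1) (hfix : ∀ i, π i = i → ¬ Even (P.a i))
    (hc : ∀ i, c i * c (π i) = P.h (e i)) :
    P.antipodeCoeff π c P.top = (-1) ^ ((P.J₃ π).card / 2) := by
  rw [antipodeCoeff_eq, h.prod_twist_eq_one hπ hfix, mul_one, h.prod_pow_top hπ hN hfix hc]

theorem card_I₁_add_card_I₃ (hN : ∀ i, P.h (e i) ^ 2 = 1) :
    (P.I₁ π).card + (P.I₃ π).card ≠ 0 ↔ ∃ i, π i = i ∧ Even (P.a i) := by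
  rw [Ne, Nat.add_eq_zero_iff, Finset.card_eq_zero, Finset.card_eq_zero, not_and_or,
    ← Ne, ← Ne, ← Finset.nonempty_iff_ne_empty, ← Finset.nonempty_iff_ne_empty]
  simp only [Finset.Nonempty, I₁, I₃, Finset.mem_filter, Finset.mem_univ, true_and]
  constructor
  · rintro (⟨i, h1, -, h2⟩ | ⟨i, h1, -, h2⟩) <;> exact ⟨i, h1, h2⟩
  · rintro ⟨i, h1, h2⟩
    exact (h_e_eq_one_or hN i).imp (fun h => ⟨i, h1, h, h2⟩) fun h => ⟨i, h1, h, h2⟩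

theorem Compatible.exists_admissible (h : P.Compatible π) (hπ : π ^ 2 = 1)
    (hN : ∀ i, P.h (e i) ^ 2 = 1) (hsqrt : IsSquare (-1 : K))
    (hcard : (P.I₁ π).card + (P.I₃ π).card ≠ 0 ∨ Even ((P.J₃ π).card / 2)) :
    ∃ c, P.Admissible π c := by
  obtain ⟨c, hc⟩ := h.exists_mul_apply_eq hπ hN hsqrt
  simp only [Admissible, qperm_mul_prod]
  rw [card_I₁_add_card_I₃ hN] at hcard
  by_cases hfix : ∃ i, π i = i ∧ Even (P.a i)
  · obtain ⟨i, hi, hev⟩ := hfix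
    rcases h.antipodeCoeff_top_eq_one_or hπ hc with h1 | h1
    · exact ⟨c, hc, h1⟩
    -- At the fixed point i the products c_j c_{π(j)} only see c_i², so the sign change preserves
    -- them; in s_{a-1} the exponent a_i - 1 is odd.
    · refine ⟨fun j => (if j = i then -1 else 1) * c j, fun j => ?_, ?_⟩
      · rw [← hc]
        by_cases hj : j = i
        · subst hj; simp [hi]
        · have : π j ≠ i := fun h' => hj (π.injective (h'.trans hi.symm))
          simp [hj, this]
      · rw [antipodeCoeff_top_neg hev, h1, neg_neg]
  · refine ⟨c, hc, ?_⟩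
    rw [h.antipodeCoeff_top_eq hπ hN (fun i hi hev => hfix ⟨i, hi, hev⟩) hc]
    exact (hcard.resolve_left hfix).neg_one_pow

theorem Admissible.card_condition (hc : P.Admissible π c) (h : P.Compatible π) (hπ : π ^ 2 = 1)
    (hN : ∀ i, P.h (e i) ^ 2 = 1) (hchar : ringChar K ≠ 2) :
    (P.I₁ π).card + (P.I₃ π).card ≠ 0 ∨ Even ((P.J₃ π).card / 2) := by
  rw [card_I₁_add_card_I₃ hN, or_iff_not_imp_left]
  intro hfix
  have := h.antipodeCoeff_top_eq hπ hN (fun i hi hev => hfix ⟨i, hi, hev⟩) hc.1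
  rw [antipodeCoeff_top hc] at this
  exact (neg_one_pow_eq_one_iff_even (Ring.neg_one_ne_one_of_char_ne_two hchar)).1 this.symm

end QCIParam

/-! ### Antipodes of bi-Frobenius algebras -/

section BiFrobenius

variable {K A : Type*} [Field K] [Ring A] [Algebra K A]

theorem IsFrobeniusHom.eq_zero_of_mul_right {φ : Module.Dual K A} (hφ : IsFrobeniusHom φ) {y : A}
    (hy : ∀ a, φ (y * a) = 0) : y = 0 := by
  refine (Module.forall_dual_apply_eq_zero_iff K y).1 fun f => ?_
  obtain ⟨a, ha⟩ := hφ f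
  rw [ha, hy]

theorem IsFrobeniusHom.eq_zero_of_mul_left [FiniteDimensional K A] {φ : Module.Dual K A}
    (hφ : IsFrobeniusHom φ) {y : A} (hy : ∀ a, φ (a * y) = 0) : y = 0 := by
  let F : A →ₗ[K] Module.Dual K A := (LinearMap.mul K A).flip.compr₂ φ
  have hF (a x : A) : F a x = φ (x * a) := rfl
  have hsurj : Function.Surjective F := fun f => by
    obtain ⟨a, ha⟩ := hφ f
    exact ⟨a, LinearMap.ext fun x => (ha x).symm⟩
  have hinj : Function.Injective F :=
    (LinearMap.injective_iff_surjective_of_finrank_eq_finrank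
      (Subspace.dual_finrank_eq).symm).2 hsurj
  refine hinj (LinearMap.ext fun x => ?_)
  rw [hF, hy, map_zero, LinearMap.zero_apply]

variable [Coalgebra K A]

/-- The value of `f ⊗ g` on `Δ c`. -/
noncomputable def comulPairing (c : A) (f g : Module.Dual K A) : K :=
  TensorProduct.lid K K (TensorProduct.map f g (Coalgebra.comul (R := K) c))

theorem apply_coalgRightAct (c : A) (f g : Module.Dual K A) :
    g (coalgRightAct c f) = comulPairing c f g := by
  rw [coalgRightAct, comulPairing]
  induction Coalgebra.comul (R := K) c using TensorProduct.induction_on with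
  | zero => simp
  | tmul y z => simp
  | add y z hy hz => simp only [map_add, hy, hz]

theorem comulPairing_counit_right (c : A) (f : Module.Dual K A) :
    comulPairing c f Coalgebra.counit = f c := by
  have h := Coalgebra.lTensor_counit_comul (R := K) c
  have h2 : comulPairing c f Coalgebra.counit = f (TensorProduct.rid K A
      (LinearMap.lTensor A Coalgebra.counit (Coalgebra.comul (R := K) c))) := by
    rw [comulPairing]
    induction Coalgebra.comul (R := K) c using TensorProduct.induction_on with
    | zero => simp
    | tmul y z => simp [mul_comm]
    | add y z hy hz => simp only [map_add, hy, hz]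
  rw [h2, h, TensorProduct.rid_tmul, one_smul]

theorem comulPairing_counit_left (c : A) (f : Module.Dual K A) :
    comulPairing c Coalgebra.counit f = f c := by
  have h := Coalgebra.rTensor_counit_comul (R := K) c
  rw [← apply_coalgRightAct, coalgRightAct, h, TensorProduct.lid_tmul, one_smul]

theorem apply_biFrobeniusAntipode (φ g : Module.Dual K A) (t a : A) :
    g (biFrobeniusAntipode φ t a) = comulPairing t (φ ∘ₗ LinearMap.mulRight K a) g :=
  apply_coalgRightAct _ _ _

namespace IsBiFrobenius

variable [FiniteDimensional K A] {φ : Module.Dual K A} {t : A}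

local notation "ε" => Coalgebra.counit (R := K) (A := A)
local notation "S" => biFrobeniusAntipode φ t

theorem antipode_surjective (H : IsBiFrobenius φ t) : Function.Surjective S := fun y => by
  obtain ⟨f, hf⟩ := H.frobenius_coalgebra y
  obtain ⟨a, ha⟩ := H.frobenius_algebra f
  refine ⟨a, ?_⟩
  rw [hf, show f = φ ∘ₗ LinearMap.mulRight K a from LinearMap.ext ha]
  rfl

theorem antipode_injective (H : IsBiFrobenius φ t) : Function.Injective S :=
  LinearMap.injective_iff_surjective.2 H.antipode_surjective

/-- Apply ε to S(a) = ∑ φ(t₁a)t₂ and use that S preserves ε. -/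
theorem apply_integral_mul (H : IsBiFrobenius φ t) (a : A) : φ (t * a) = ε a := by
  rw [← H.counit_antipode, apply_biFrobeniusAntipode, comulPairing_counit_right]
  rfl

theorem apply_integral (H : IsBiFrobenius φ t) : φ t = 1 := by
  rw [← mul_one t, H.apply_integral_mul, H.counit_one]

theorem integral_mul (H : IsBiFrobenius φ t) (a : A) : t * a = ε a • t := by
  refine sub_eq_zero.1 (H.frobenius_algebra.eq_zero_of_mul_right fun b => ?_)
  rw [sub_mul, map_sub, mul_assoc, H.apply_integral_mul, smul_mul_assoc, map_smul,
    H.apply_integral_mul, H.counit_mul, smul_eq_mul, sub_self]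

theorem mul_antipode_integral (H : IsBiFrobenius φ t) (a : A) : a * S t = ε a • S t := by
  obtain ⟨b, rfl⟩ := H.antipode_surjective a
  rw [← H.antipode_mul, H.integral_mul, map_smul, H.counit_antipode]

/-- For a two-sided integral φ(t₁t) = ε(t₁), so S(t) = t and in particular φ(S(t)) = φ(t). -/
theorem apply_antipode_integral (H : IsBiFrobenius φ t) (ht : ∀ a, a * t = ε a • t) :
    φ (S t) = 1 := by
  have : φ ∘ₗ LinearMap.mulRight K t = ε := by
    ext a
    simp [ht, H.apply_integral]
  rw [apply_biFrobeniusAntipode, this, comulPairing_counit_left, H.apply_integral]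

theorem comulPairing_antipode (H : IsBiFrobenius φ t) (hS : S t = t) (f g : Module.Dual K A) :
    comulPairing t f g = comulPairing t (g ∘ₗ S) (f ∘ₗ S) := by
  conv_lhs => rw [comulPairing, ← hS, H.comul_antipode]
  rw [comulPairing]
  generalize S = T
  induction Coalgebra.comul (R := K) t using TensorProduct.induction_on with
  | zero => simp
  | tmul y z => simp [mul_comm]
  | add y z hy hz => simp only [map_add, hy, hz]

/-- The square of the antipode is the inverse of the Nakayama automorphism when `t` is fixed by the
antipode. -/
theorem antipode_antipode_nakayama (H : IsBiFrobenius φ t) (hS : S t = t) {N : A → A}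
    (hN : ∀ x y, φ (x * y) = φ (y * N x)) (hN1 : N 1 = 1) (hsurj : Function.Surjective N)
    (b : A) : S (S (N b)) = b := by
  -- φ∘S is again of the form φ(· w); writing w = N(w') lets w be moved to the left side inside φ.
  obtain ⟨w, hw⟩ := H.frobenius_algebra (φ ∘ₗ S)
  obtain ⟨w', rfl⟩ := hsurj w
  simp only [LinearMap.comp_apply] at hw
  have key (b : A) : S (S (N w' * N b)) = w' * b := by
    refine sub_eq_zero.1 (H.frobenius_algebra.eq_zero_of_mul_right fun a => ?_)
    rw [sub_mul, map_sub, sub_eq_zero]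
    -- φ(S(x)S(b)) = φ(S(bx)) = φ(bxw) = φ(x w N(b)). With Δ(t) = S(t₂) ⊗ S(t₁) this converts two
    -- applications of S into one.
    have h1 : (φ ∘ₗ LinearMap.mulRight K (S b)) ∘ₗ S
        = φ ∘ₗ LinearMap.mulRight K (N w' * N b) := by
      ext x
      simp only [LinearMap.comp_apply, LinearMap.mulRight_apply]
      rw [← H.antipode_mul, hw, mul_assoc b, hN b, mul_assoc]
    calc φ (S (S (N w' * N b)) * a)
        = ((φ ∘ₗ LinearMap.mulRight K a) ∘ₗ S) (S (N w' * N b)) := rfl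
      _ = comulPairing t ((φ ∘ₗ LinearMap.mulRight K (S b)) ∘ₗ S)
            ((φ ∘ₗ LinearMap.mulRight K a) ∘ₗ S) := by
          rw [h1, apply_biFrobeniusAntipode]
      _ = (φ ∘ₗ LinearMap.mulRight K (S b)) (S a) := by
          rw [← H.comulPairing_antipode hS, apply_biFrobeniusAntipode]
      _ = φ (S (b * a)) := by rw [H.antipode_mul]; rfl
      _ = φ (w' * b * a) := by rw [hw, ← hN, mul_assoc]
  have h1 : S (S (N w')) = w' := by simpa [hN1] using key 1
  have h2 := key b
  rw [H.antipode_mul, H.antipode_mul, h1] at h2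
  -- w' is cancelled without knowing it is a unit: if w'z = 0, then φ(S(x)S(z)) = φ(zxw) = φ(w'zx)
  -- must vanish for all x. The rearrangement below uses this with the order of factors supplied by
  -- N.
  have h3 : w' * (S (S (N b)) - b) = 0 := by rw [mul_sub, h2, sub_self]
  refine sub_eq_zero.1 (H.antipode_injective ?_)
  rw [map_zero]
  refine H.frobenius_algebra.eq_zero_of_mul_left fun a => ?_
  obtain ⟨x, rfl⟩ := H.antipode_surjective a
  rw [← H.antipode_mul, hw, ← hN, ← mul_assoc, h3, zero_mul, map_zero]

end IsBiFrobenius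

end BiFrobenius

/-! ### The converse: what a permutation antipode forces -/

namespace QCIParam

variable {K : Type*} [Field K] {n : ℕ} {P : QCIParam K n} {π : Equiv.Perm (Fin n)} {c : Fin n → K}

theorem gen_pow_ne_zero {i : Fin n} {k : ℕ} (hk : k < P.a i) : P.gen i ^ k ≠ 0 := by
  have h (k : ℕ) : ∃ r : K, r ≠ 0 ∧ P.gen i ^ k = r • P.x (Pi.single i k) := by
    induction k with
    | zero => exact ⟨1, one_ne_zero, by simp [x_zero]⟩
    | succ k ih =>
      obtain ⟨r, hr, h⟩ := ih
      refine ⟨r * P.npair (Pi.single i 1) (Pi.single i k), mul_ne_zero hr (P.npair_ne_zero _ _), ?_⟩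
      rw [pow_succ', h, mul_smul_comm, gen_mul_x, smul_smul, ← Pi.single_add]
  obtain ⟨r, hr, h⟩ := h k
  rw [h]
  refine smul_ne_zero hr (P.x_ne_zero (P.mem_V.2 fun j => ?_))
  by_cases hj : j = i
  · subst hj; simpa using hk
  · have := P.two_le_a j
    simp [Pi.single_eq_of_ne hj]; omega

theorem gen_mul_gen_ne_zero {i j : Fin n} (hij : i ≠ j) : P.gen i * P.gen j ≠ 0 := by
  rw [← x_single P j, gen_mul_x]
  refine smul_ne_zero (P.npair_ne_zero _ _) (P.x_ne_zero (P.mem_V.2 fun k => ?_))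
  have := P.two_le_a k
  by_cases hi : k = i
  · subst hi; simp [Pi.single_eq_of_ne hij]; omega
  · by_cases hj : k = j
    · subst hj; simp [Pi.single_eq_of_ne hi]; omega
    · simp [Pi.single_eq_of_ne hi, Pi.single_eq_of_ne hj]; omega

/-- A unit vector is not a sum of two nonzero exponent vectors, so the degree-one coefficient is a
derivation over the augmentation. -/
theorem coeff_single_mul (i : Fin n) (y z : P.Alg) :
    P.coeff (Pi.single i 1) (y * z)
      = P.counitMap y * P.coeff (Pi.single i 1) z + P.coeff (Pi.single i 1) y * P.counitMap z := by
  induction y using induction_x with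
  | hadd y y' h h' => simp only [add_mul, map_add, h, h']; ring
  | hsmul r y h => simp only [smul_mul_assoc, map_smul, h, smul_eq_mul]; ring
  | hx u hu =>
    induction z using induction_x with
    | hadd y y' h h' => simp only [mul_add, map_add, h, h']; ring
    | hsmul r y h => simp only [mul_smul_comm, map_smul, h, smul_eq_mul]; ring
    | hx v hv =>
      have hne : (Pi.single i 1 : Fin n → ℕ) ≠ 0 := by simp
      rw [x_mul_x, map_smul, counitMap_x, counitMap_x, P.coeff_x (P.single_mem i),
        P.coeff_x (P.single_mem i), P.coeff_x (P.single_mem i)]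
      by_cases hu : u = 0
      · subst hu
        by_cases hv : v = 0
        · subst hv; simp [hne.symm]
        · simp [hv, hne.symm]
      · by_cases hv : v = 0
        · subst hv; simp [hu]
        · have : u + v ≠ Pi.single i 1 := by
            intro h
            obtain ⟨j, hj⟩ := Function.ne_iff.1 hu
            obtain ⟨k, hk⟩ := Function.ne_iff.1 hv
            have hs (l : Fin n) (hl : u l ≠ 0 ∨ v l ≠ 0) : l = i := by
              by_contra hli
              have := congrFun h l
              rw [Pi.single_eq_of_ne hli, Pi.add_apply] at this
              omega
            have h1 := hs j (Or.inl hj)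
            have h2 := hs k (Or.inr hk)
            subst h1 h2
            have := congrFun h k
            rw [Pi.single_eq_same, Pi.add_apply] at this
            simp only [Pi.zero_apply] at hj hk
            omega
          simp [hu, hv, this]

theorem mul_x_top (y : P.Alg) : y * P.x P.top = P.counitMap y • P.x P.top := by
  induction y using induction_x with
  | hadd y y' h h' => simp only [add_mul, add_smul, map_add, h, h']
  | hsmul r y h => simp only [smul_mul_assoc, map_smul, h, smul_eq_mul, mul_smul]
  | hx u hu =>
    rw [x_mul_x, counitMap_x]
    by_cases h : u = 0
    · subst h; simp
    · rw [x_eq_zero, if_neg h, smul_zero, zero_smul]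
      simp only [V, Finset.mem_Iic, add_le_iff_nonpos_left, nonpos_iff_eq_zero, h, not_false_iff]

theorem x_top_mul (y : P.Alg) : P.x P.top * y = P.counitMap y • P.x P.top := by
  induction y using induction_x with
  | hadd y y' h h' => simp only [mul_add, add_smul, map_add, h, h']
  | hsmul r y h => simp only [mul_smul_comm, map_smul, h, smul_eq_mul, mul_smul]
  | hx u hu =>
    rw [x_mul_x, counitMap_x]
    by_cases h : u = 0
    · subst h; simp
    · rw [x_eq_zero, if_neg h, smul_zero, zero_smul]
      simp only [V, Finset.mem_Iic, add_le_iff_nonpos_right, nonpos_iff_eq_zero, h, not_false_iff]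

theorem topDual_x_top : P.topDual (P.x P.top) = 1 := by rw [topDual_x, if_pos rfl]

theorem eq_smul_x_top_of_mul {y : P.Alg} (h : ∀ a, y * a = P.counitMap a • y) :
    y = P.topDual y • P.x P.top := by
  refine P.eq_of_topDual_mul fun a => ?_
  rw [h, smul_mul_assoc, x_top_mul, map_smul, map_smul, map_smul, topDual_x_top]
  simp [mul_comm]

/-- The Nakayama automorphism moves the test factor to the left inside `topDual`, where the integral
property applies. -/
theorem eq_smul_x_top_of_mul_left {y : P.Alg} (h : ∀ a, a * y = P.counitMap a • y) :
    y = P.topDual y • P.x P.top := by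
  refine P.eq_of_topDual_mul fun a => ?_
  obtain ⟨b, rfl⟩ := P.nakayama.surjective a
  rw [← isNakayamaAutomorphism_nakayama, ← isNakayamaAutomorphism_nakayama, h, mul_smul_comm,
    mul_x_top, map_smul, map_smul, map_smul, topDual_x_top]
  simp [mul_comm]

/-- A multiplicative functional kills the nilpotent generators. -/
theorem algebra_hom_eq_counitMap {f : Module.Dual K P.Alg} (h1 : f 1 = 1)
    (hmul : ∀ y z, f (y * z) = f y * f z) : f = P.counitMap := by
  have hpow (y : P.Alg) (k : ℕ) : f (y ^ k) = f y ^ k := by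
    induction k with
    | zero => simp [h1]
    | succ k ih => rw [pow_succ, hmul, ih, pow_succ]
  have hgen (i : Fin n) : f (P.gen i) = 0 := by
    refine eq_zero_of_pow_eq_zero (n := P.a i) ?_
    rw [← hpow, gen_pow, map_zero]
  refine P.stdBasis_ext fun v _ => ?_
  rw [counitMap_x]
  induction v using vec_induction with
  | h0 => rw [x_zero, h1, if_pos rfl]
  | h1 v i =>
    have h2 := congrArg f (P.gen_mul_x i v)
    rw [hmul, hgen, zero_mul, map_smul, smul_eq_mul] at h2
    rw [(mul_eq_zero.1 h2.symm).resolve_left (P.npair_ne_zero _ _), if_neg]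
    intro h
    have := congrFun h i
    simp at this

theorem Compatible.eq_antipodeMap (h : P.Compatible π) {T : P.Alg →ₗ[K] P.Alg} (h1 : T 1 = 1)
    (hmul : ∀ y z, T (y * z) = T z * T y) (hgen : ∀ i, T (P.gen i) = c i • P.gen (π i)) :
    T = P.antipodeMap π c := by
  refine P.stdBasis_ext fun v hv => ?_
  clear hv
  induction v using vec_induction with
  | h0 => rw [x_zero, h1, h.antipodeMap_one]
  | h1 v i ih =>
    have h2 : P.x (v + Pi.single i 1) = (P.npair (Pi.single i 1) v)⁻¹ • (P.gen i * P.x v) := by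
      rw [gen_mul_x, smul_smul, inv_mul_cancel₀ (P.npair_ne_zero _ _), one_smul]
    have h3 : P.antipodeMap π c (P.gen i) = c i • P.gen (π i) := by
      rw [← x_single, h.antipodeMap_x, antipodeCoeff_single, permVec_single, x_single]
    rw [h2, map_smul, map_smul, hmul, h.antipodeMap_mul, ih, hgen, h3]

section Converse

variable {T : P.Alg →ₗ[K] P.Alg}

/-- A permutation anti-automorphism preserving the augmentation permutes the generators up to
scalars. -/
theorem exists_perm_gen (hT : P.IsPermutationMap T) (hinj : Function.Injective T) (h1 : T 1 = 1)
    (hmul : ∀ y z, T (y * z) = T z * T y) (hcounit : ∀ y, P.counitMap (T y) = P.counitMap y) :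
    ∃ (π : Equiv.Perm (Fin n)) (c : Fin n → K),
      (∀ i, c i ≠ 0) ∧ ∀ i, T (P.gen i) = c i • P.gen (π i) := by
  obtain ⟨σ, c, hσ⟩ := hT
  have hc (v : P.V) : c v ≠ 0 := fun h => by
    have := hσ v
    rw [h, zero_smul, ← map_zero T] at this
    exact P.x_ne_zero v.2 (hinj this)
  let E (i : Fin n) : P.V := ⟨Pi.single i 1, P.single_mem i⟩
  have hE : Function.Injective E := fun i j h => by
    have := congrFun (congrArg Subtype.val h) i
    by_contra hij
    simp [E, Pi.single_eq_of_ne hij] at this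
  -- If x_j came from a monomial of degree at least two, it would be, up to a scalar, a product of
  -- two elements of augmentation zero, whose degree-one coefficients vanish.
  have key (j : Fin n) : ∃ i, σ (E i) = E j := by
    obtain ⟨v, hv⟩ := σ.surjective (E j)
    have hTv : T (P.x v) = c v • P.x (Pi.single j 1) := by rw [hσ, hv]
    have hv0 : (v : Fin n → ℕ) ≠ 0 := fun h => by
      rw [h, x_zero, h1] at hTv
      have := congrArg P.counitMap hTv
      rw [counitMap_one, map_smul, counitMap_x] at this
      simp at this
    obtain ⟨v, hvV⟩ := v
    obtain ⟨i, hi⟩ := Function.ne_iff.1 hv0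
    obtain ⟨u, rfl⟩ : ∃ u, v = u + Pi.single i 1 := by
      refine ⟨v - Pi.single i 1, (tsub_add_cancel_of_le fun k => ?_).symm⟩
      by_cases hk : k = i
      · subst hk
        simpa [Nat.one_le_iff_ne_zero] using hi
      · simp [Pi.single_eq_of_ne hk]
    by_cases hu : u = 0
    · subst hu
      refine ⟨i, ?_⟩
      rw [← hv]
      exact congrArg σ (Subtype.ext (zero_add _).symm)
    · exfalso
      have h2 := congrArg (fun y => P.coeff (Pi.single j 1) (T y)) (P.gen_mul_x i u)
      simp only [map_smul, hTv] at h2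
      rw [hmul, coeff_single_mul, hcounit, hcounit, counitMap_x, if_neg hu, ← x_single,
        counitMap_x, P.coeff_x (P.single_mem j)] at h2
      simp [hc, P.npair_ne_zero] at h2
  choose ρ hρ using key
  have hρinj : Function.Injective ρ := fun j k h => hE (by rw [← hρ j, h, hρ])
  let ρ' : Equiv.Perm (Fin n) := Equiv.ofBijective ρ (Finite.injective_iff_bijective.1 hρinj)
  refine ⟨ρ'.symm, fun i => c (E i), fun i => hc _, fun i => ?_⟩
  have h2 : σ (E i) = E (ρ'.symm i) := by
    have := hρ (ρ'.symm i)
    rwa [show ρ (ρ'.symm i) = i from ρ'.apply_symm_apply i] at this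
  have h3 := hσ (E i)
  rw [h2] at h3
  simpa only [E, x_single] using h3

/-- The image of x_i^(a_i) = 0 bounds a_{π(i)} by a_i, and π² = 1 gives equality. The image of a
commutation relation compares the q's because x_{π(i)} x_{π(j)} ≠ 0. -/
theorem compatible_of_antihom (h1 : T 1 = 1)
    (hmul : ∀ y z, T (y * z) = T z * T y) (hπ : π ^ 2 = 1) (hc : ∀ i, c i ≠ 0)
    (hgen : ∀ i, T (P.gen i) = c i • P.gen (π i)) : P.Compatible π := by
  have hpow (y : P.Alg) (k : ℕ) : T (y ^ k) = T y ^ k := by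
    induction k with
    | zero => simp [h1]
    | succ k ih => rw [pow_succ, hmul, ih, pow_succ']
  have hle (i : Fin n) : P.a (π i) ≤ P.a i := by
    by_contra! hlt
    have h2 := hpow (P.gen i) (P.a i)
    rw [gen_pow, map_zero, hgen, smul_pow] at h2
    exact smul_ne_zero (pow_ne_zero _ (hc i)) (gen_pow_ne_zero hlt) h2.symm
  refine ⟨fun i => le_antisymm (hle i) ?_, fun i j => ?_⟩
  · have := hle (π i)
    rwa [apply_apply_of_sq hπ] at this
  · by_cases hij : i = j
    · subst hij; rw [P.q_self, P.q_self]
    · have h2 := congrArg T (P.gen_comm j i)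
      rw [map_smul, hmul, hmul, hgen, hgen, smul_mul_smul_comm, smul_mul_smul_comm,
        P.gen_comm (π i) (π j), smul_smul, smul_smul] at h2
      have h3 := gen_mul_gen_ne_zero (P := P) (fun h => hij (π.injective h))
      have h4 := smul_left_injective K h3 h2
      refine mul_left_cancel₀ (mul_ne_zero (hc i) (hc j)) ?_
      linear_combination h4

end Converse

/-- Each Frobenius form is the other one translated by an element; the two elements are mutually
inverse by nondegeneracy. -/
theorem exists_conj_nakayama {φ : Module.Dual K P.Alg} (hφ : IsFrobeniusHom φ) :
    ∃ u u' : P.Alg, u * u' = 1 ∧ u' * u = 1 ∧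
      ∀ x y, φ (x * y) = φ (y * (u * P.nakayama x * u')) := by
  obtain ⟨u, hu⟩ := P.topDual_isFrobeniusHom φ
  obtain ⟨u', hu'⟩ := hφ P.topDual
  have h1 : u * u' = 1 := by
    refine sub_eq_zero.1 (hφ.eq_zero_of_mul_left fun a => ?_)
    rw [mul_sub, map_sub, ← mul_assoc, ← hu', ← hu, mul_one, sub_self]
  have h2 : u' * u = 1 := by
    refine sub_eq_zero.1 (P.topDual_isFrobeniusHom.eq_zero_of_mul_left fun a => ?_)
    rw [mul_sub, map_sub, ← mul_assoc, ← hu, ← hu', mul_one, sub_self]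
  refine ⟨u, u', h1, h2, fun x y => ?_⟩
  rw [hu, hu, mul_assoc, isNakayamaAutomorphism_nakayama, mul_assoc y _ u, mul_assoc (u * _) u',
    h2, mul_one, mul_assoc y]

theorem sq_eq_one_and_mul_apply_eq {φ : Module.Dual K P.Alg} {t : P.Alg} [Coalgebra K P.Alg]
    (H : IsBiFrobenius φ t) (ht : biFrobeniusAntipode φ t t = t)
    (hgen : ∀ i, biFrobeniusAntipode φ t (P.gen i) = c i • P.gen (π i)) :
    π ^ 2 = 1 ∧ ∀ i, c i * c (π i) = P.h (e i) := by
  obtain ⟨u, u', huu', hu'u, hN⟩ := exists_conj_nakayama H.frobenius_algebra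
  have hNN := H.antipode_antipode_nakayama ht hN (by rw [map_one, mul_one, huu']) fun z =>
    ⟨P.nakayama.symm (u' * z * u), by
      rw [AlgEquiv.apply_symm_apply]
      calc u * (u' * z * u) * u' = (u * u') * z * (u * u') := by simp only [mul_assoc]
        _ = z := by rw [huu', one_mul, mul_one]⟩
  set S := biFrobeniusAntipode φ t
  have hmul (y z : P.Alg) : S (S (y * z)) = S (S y) * S (S z) := by
    rw [H.antipode_mul, H.antipode_mul]
  set U := S (S u)
  have hU : S (S u') * U = 1 := by rw [← hmul, hu'u, H.antipode_one, H.antipode_one]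
  have hU0 : P.counitMap U ≠ 0 := by
    have := congrArg P.counitMap hU
    rw [counitMap_mul, counitMap_one] at this
    exact right_ne_zero_of_mul_eq_one this
  -- This is S²(N(x_i)) = x_i with the conjugating unit cleared. In degree one U acts by the nonzero
  -- scalar ε(U) on either side and cancels.
  have h2 (i : Fin n) : (P.h (e i))⁻¹ • c i • c (π i) • (U * P.gen (π (π i))) = P.gen i * U := by
    have h3 := congrArg (· * U) (hNN (P.gen i))
    rw [hmul, hmul, mul_assoc, hU, mul_one, ← x_single P i, nakayama_x, ← h_e, map_smul, map_smul,
      x_single, hgen, map_smul, hgen] at h3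
    simpa only [mul_smul_comm] using h3
  have h4 (i : Fin n) : (P.h (e i))⁻¹ * (c i * c (π i)) *
      (if (Pi.single (π (π i)) 1 : Fin n → ℕ) = Pi.single i 1 then 1 else 0) = 1 := by
    have h5 := congrArg (P.coeff (Pi.single i 1)) (h2 i)
    rw [map_smul, map_smul, map_smul, coeff_single_mul, coeff_single_mul, ← x_single P i,
      ← x_single P (π (π i)), counitMap_x, counitMap_x, P.coeff_x (P.single_mem i),
      P.coeff_x (P.single_mem i)] at h5
    refine mul_right_cancel₀ hU0 ?_
    simp only [Pi.single_eq_zero_iff, one_ne_zero, if_false, mul_zero, zero_mul, if_true, add_zero,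
      zero_add, smul_eq_mul] at h5
    rw [← h5]
    ring
  have h6 (i : Fin n) : π (π i) = i := by
    have h5 := h4 i
    split_ifs at h5 with h
    · by_contra hne
      have := congrFun h i
      rw [Pi.single_eq_same, Pi.single_eq_of_ne (Ne.symm hne)] at this
      exact zero_ne_one this
    · simp at h5
  refine ⟨Equiv.ext fun i => by rw [sq, Equiv.Perm.mul_apply, h6, Equiv.Perm.one_apply],
    fun i => ?_⟩
  have h5 := h4 i
  rw [h6, if_pos rfl, mul_one] at h5
  have hne : P.h (e i) ≠ 0 := by rw [h_e]; exact P.hnat_ne_zero _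
  exact (inv_mul_eq_one₀ hne).1 h5 |>.symm

/-- t is a right integral and S(t) a left one, so both lie on the line of x_{a-1}; φ takes the value
1 on each, hence they agree. -/
theorem antipode_x_top {φ : Module.Dual K P.Alg} {t : P.Alg} [Coalgebra K P.Alg]
    (H : IsBiFrobenius φ t) :
    biFrobeniusAntipode φ t t = t ∧ biFrobeniusAntipode φ t (P.x P.top) = P.x P.top := by
  have hε : Coalgebra.counit (R := K) (A := P.Alg) = P.counitMap :=
    algebra_hom_eq_counitMap H.counit_one H.counit_mul
  have ht : t = P.topDual t • P.x P.top :=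
    eq_smul_x_top_of_mul fun a => by rw [H.integral_mul, hε]
  have hSt : biFrobeniusAntipode φ t t = P.topDual (biFrobeniusAntipode φ t t) • P.x P.top :=
    eq_smul_x_top_of_mul_left fun a => by rw [H.mul_antipode_integral, hε]
  have hτ : P.topDual t ≠ 0 := fun h => by
    have h1 := H.apply_integral
    rw [ht, h, zero_smul, map_zero] at h1
    exact zero_ne_one h1
  have h1 : φ (biFrobeniusAntipode φ t t) = 1 := H.apply_antipode_integral fun a => by
    rw [hε]
    conv_lhs => rw [ht]
    rw [mul_smul_comm, mul_x_top, smul_comm, ← ht]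
  have h2 : P.x P.top = (P.topDual t)⁻¹ • t := by
    conv_rhs => rw [ht]
    rw [map_smul, topDual_x_top, smul_eq_mul, mul_one, smul_smul, inv_mul_cancel₀ hτ, one_smul]
  have h3 : biFrobeniusAntipode φ t t = t := by
    rw [h2, smul_smul] at hSt
    rw [hSt, map_smul, H.apply_integral, smul_eq_mul, mul_one] at h1
    rw [hSt, h1, one_smul]
  exact ⟨h3, by rw [h2, map_smul, h3]⟩

theorem AdmitsBiFrobeniusPerm.exists_admissible (hA : P.AdmitsBiFrobeniusPerm) :
    ∃ (π : Equiv.Perm (Fin n)) (c : Fin n → K),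
      P.Compatible π ∧ π ^ 2 = 1 ∧ P.Admissible π c ∧ ∀ i, P.h (e i) ^ 2 = 1 := by
  obtain ⟨_, φ, t, H, hperm⟩ := hA
  have hε : Coalgebra.counit (R := K) (A := P.Alg) = P.counitMap :=
    algebra_hom_eq_counitMap H.counit_one H.counit_mul
  obtain ⟨ht, htop⟩ := antipode_x_top H
  obtain ⟨π, c, hc, hgen⟩ := exists_perm_gen hperm H.antipode_injective H.antipode_one
    H.antipode_mul fun y => by rw [← hε, H.counit_antipode]
  obtain ⟨hπ, hcc⟩ := sq_eq_one_and_mul_apply_eq H ht hgen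
  have hcomp := compatible_of_antihom H.antipode_one H.antipode_mul hπ hc hgen
  refine ⟨π, c, hcomp, hπ, ⟨hcc, ?_⟩, fun i => ?_⟩
  · have hS := hcomp.eq_antipodeMap H.antipode_one H.antipode_mul hgen
    rw [hS, hcomp.antipodeMap_x, hcomp.permVec_top] at htop
    rw [qperm_mul_prod]
    refine smul_left_injective K (P.x_ne_zero P.top_mem) ?_
    simpa using htop
  -- Compatibility inverts h along π, while c_i c_{π(i)} is symmetric in i and π(i), so h_{e_i}
  -- equals its own inverse.
  · have h1 := hcomp.h_e_apply i
    rw [← hcc (π i), apply_apply_of_sq hπ, mul_comm, hcc i] at h1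
    have hne : P.h (e i) ≠ 0 := by rw [h_e]; exact P.hnat_ne_zero _
    rw [sq]
    nth_rewrite 1 [h1]
    exact inv_mul_cancel₀ hne

end QCIParam

theorem theorem7p3 {K : Type*} [Field K] (hchar : ringChar K ≠ 2) (hsqrt : IsSquare (-1 : K))
    {n : ℕ} (hn : 2 ≤ n) (P : QCIParam K n) :
    (P.AdmitsBiFrobeniusPerm ↔
      P.NakayamaSqEqId ∧
        ∃ π : Equiv.Perm (Fin n), P.Compatible π ∧ π ^ 2 = 1 ∧
          ((P.I₁ π).card + (P.I₃ π).card ≠ 0 ∨ Even ((P.J₃ π).card / 2))) ∧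
    (P.NakayamaSqEqId →
      ∀ π : Equiv.Perm (Fin n), P.Compatible π → π ^ 2 = 1 →
        ((P.I₁ π).card + (P.I₃ π).card ≠ 0 ∨ Even ((P.J₃ π).card / 2)) →
        (∃ c : Fin n → K, P.Admissible π c) ∧
        ∀ c : Fin n → K, P.Admissible π c →
          ∃ _ : Coalgebra K P.Alg,
            Coalgebra.counit (R := K) (A := P.Alg) = P.counitMap ∧
            Coalgebra.comul (R := K) (A := P.Alg) = P.comulMap π c ∧
            IsBiFrobenius P.topDual (P.x P.top) ∧
            biFrobeniusAntipode P.topDual (P.x P.top) = P.antipodeMap π c ∧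
            P.IsPermutationMap (biFrobeniusAntipode P.topDual (P.x P.top))) := by
  have hn' : 0 < n := by omega
  refine ⟨⟨fun hA => ?_, ?_⟩, fun hN π hcomp hπ hcard => ?_⟩
  · obtain ⟨π, c, hcomp, hπ, hc, hN⟩ := hA.exists_admissible
    exact ⟨P.nakayamaSqEqId_iff.2 hN, π, hcomp, hπ, hc.card_condition hcomp hπ hN hchar⟩
  · rintro ⟨hN, π, hcomp, hπ, hcard⟩
    rw [QCIParam.nakayamaSqEqId_iff] at hN
    obtain ⟨c, hc⟩ := hcomp.exists_admissible hπ hN hsqrt hcard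
    refine ⟨hcomp.coalgebra hn' hc, P.topDual, P.x P.top, hcomp.isBiFrobenius hn' hπ hc, ?_⟩
    rw [hcomp.biFrobeniusAntipode_eq hn' hc]
    exact hcomp.isPermutationMap
  · rw [QCIParam.nakayamaSqEqId_iff] at hN
    refine ⟨hcomp.exists_admissible hπ hN hsqrt hcard, fun c hc => ?_⟩
    refine ⟨hcomp.coalgebra hn' hc, rfl, rfl, hcomp.isBiFrobenius hn' hπ hc,
      hcomp.biFrobeniusAntipode_eq hn' hc, ?_⟩
    rw [hcomp.biFrobeniusAntipode_eq hn' hc]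
    exact hcomp.isPermutationMap
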